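/- Let $d\ge 0$ be a fixed integer. An instance of Vector $d$-Connectivity is a finite simple undirected graph $G=(V,E)$ together with a demand function $\phi\colon V\to\{0,\dots,d\}$. A set $S\subseteq V$ is a vector connectivity set (feasible solution) for $(G,\phi)$ if every vertex $v\in V\setminus S$ has at least $\phi(v)$ paths to vertices of $S$ that are pairwise vertex-disjoint except for sharing $v$; let $\mathrm{opt}(G,\phi)$ denote the minimum size of such a set. Theorem. For every fixed $d$, Vector $d$-Connectivity admits a polynomial-time factor-$d$ approximation: there is a (deterministic) algorithm that, given an instance $(G,\phi)$, outputs, in time polynomial in the size of the instance, a vector connectivity set for $(G,\phi)$ of size at most $d\cdot\mathrm{opt}(G,\phi)$. -/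

import Mathlib

/-- An instance of the (optimisation version of the) Vector `d`-Connectivity problem: a finite
simple graph, whose vertices are named `0, …, n - 1` so that it can be given to a machine, and a
demand in `{0, …, d}` for each vertex. -/
structure VectorConnectivityInstance (d : ℕ) where
  /-- the number of vertices -/
  n : ℕ
  /-- the graph -/
  graph : SimpleGraph (Fin n)
  /-- the demand function -/
  demand : Fin n → Fin (d + 1)

/-- There are `r` paths from `v` to vertices of `S` that are pairwise vertex-disjoint except that
they share `v`. (Used only for `v ∉ S`; then no path is trivial, so the endpoints in `S` are
pairwise distinct as well.) -/
def HasDisjointPaths {V : Type*} (G : SimpleGraph V) (v : V) (S : Finset V) (r : ℕ) : Prop :=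
  ∃ (t : Fin r → V) (p : ∀ i, G.Path v (t i)),
    (∀ i, t i ∈ S) ∧
    ∀ i j, i ≠ j → ∀ x,
      x ∈ (p i : G.Walk v (t i)).support → x ∈ (p j : G.Walk v (t j)).support → x = v

namespace VectorConnectivityInstance

variable {d : ℕ}

/-- `S` is a vector connectivity set (a feasible solution): each vertex `v` outside `S` has at
least as many disjoint paths to `S` as its demand. -/
def IsVectorConnectivitySet (I : VectorConnectivityInstance d) (S : Finset (Fin I.n)) : Prop :=
  ∀ v, v ∉ S → HasDisjointPaths I.graph v S (I.demand v)

/-- The set of all vertices is feasible. -/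
theorem isVectorConnectivitySet_univ (I : VectorConnectivityInstance d) :
    I.IsVectorConnectivitySet Finset.univ :=
  fun v hv => absurd (Finset.mem_univ v) hv

/-- The minimum size of a vector connectivity set. -/
noncomputable def opt (I : VectorConnectivityInstance d) : ℕ :=
  sInf {k | ∃ S : Finset (Fin I.n), I.IsVectorConnectivitySet S ∧ S.card = k}

/-- The optimum is attained. -/
theorem exists_card_eq_opt (I : VectorConnectivityInstance d) :
    ∃ S : Finset (Fin I.n), I.IsVectorConnectivitySet S ∧ S.card = I.opt :=
  Nat.sInf_mem (s := {k | ∃ S : Finset (Fin I.n), I.IsVectorConnectivitySet S ∧ S.card = k})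
    ⟨_, Finset.univ, I.isVectorConnectivitySet_univ, rfl⟩

/-- No vector connectivity set is smaller than the optimum. -/
theorem opt_le_card (I : VectorConnectivityInstance d) {S : Finset (Fin I.n)}
    (hS : I.IsVectorConnectivitySet S) : I.opt ≤ S.card :=
  Nat.sInf_le ⟨S, hS, rfl⟩

open Classical in
/-- The string that describes an instance, over the finite alphabet `{0, …, d} ⊔ {false, true}`:
the `n` demands, followed by the `n * n` entries of the adjacency matrix, row by row. -/
noncomputable def encode (I : VectorConnectivityInstance d) : List (Fin (d + 1) ⊕ Bool) :=
  (List.finRange I.n).map (fun v => Sum.inl (I.demand v)) ++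
    (List.finRange I.n ×ˢ List.finRange I.n).map
      (fun p => Sum.inr (decide (I.graph.Adj p.1 p.2)))

/-- An instance is determined by its description. -/
theorem encode_injective :
    Function.Injective (encode : VectorConnectivityInstance d → List (Fin (d + 1) ⊕ Bool)) := by
  rintro ⟨n, G, f⟩ ⟨m, H, g⟩ h
  have h1 := congrArg (List.filterMap Sum.getLeft?) h
  have h2 := congrArg (List.filterMap Sum.getRight?) h
  simp only [encode, List.filterMap_append, List.filterMap_map, Function.comp_def,
    Sum.getLeft?_inl, Sum.getLeft?_inr, Sum.getRight?_inl, Sum.getRight?_inr,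
    List.filterMap_none, List.append_nil, List.nil_append, List.filterMap_eq_map'] at h1 h2
  have hn : n = m := by simpa using congrArg List.length h1
  subst hn
  have hf : f = g := by
    funext v
    exact List.map_inj_left.1 h1 v (List.mem_finRange v)
  have hG : G = H := by
    ext u v
    have := List.map_inj_left.1 h2 (u, v)
      (List.mem_product.2 ⟨List.mem_finRange u, List.mem_finRange v⟩)
    simpa using this
  subst hf hG
  rfl

end VectorConnectivityInstance

/-- The string that describes a set of vertices: its `n` membership bits. -/
def encodeVertexSet {n : ℕ} (S : Finset (Fin n)) : List Bool :=
  (List.finRange n).map (fun v => decide (v ∈ S))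

/-- A vertex set is determined by its description. -/
theorem encodeVertexSet_injective {n : ℕ} :
    Function.Injective (encodeVertexSet : Finset (Fin n) → List Bool) := by
  intro S T h
  ext v
  simpa using List.map_inj_left.1 h v (List.mem_finRange v)

/-- `A` is an algorithm for Vector `d`-Connectivity that runs in polynomial time: some Turing
machine, on the description of each instance `I`, halts with the description of the vertex set
`A I` after a number of steps that is polynomially bounded in the length of its input. -/
def IsPolynomialTime {d : ℕ} (A : ∀ I : VectorConnectivityInstance d, Finset (Fin I.n)) : Prop :=
  Nonempty (Turing.TM2ComputableInPolyTime
    (VectorConnectivityInstance.encode : VectorConnectivityInstance d → List (Fin (d + 1) ⊕ Bool))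
    (id : List Bool → List Bool) (fun I => encodeVertexSet (A I)))

/-! The algorithm is a local-ratio argument over small cuts. Let `S` be the partial solution. If it
is infeasible, the fan version of Menger's theorem gives a vertex `v` and a set `Z` with fewer than
`φ v` vertices, not containing `v`, such that the part `X` reachable from `v` without entering `Z`
avoids `S`. Among all such cuts take one whose part `X` is inclusion-minimal, and add `v` and all of
`Z` to `S`. This costs at most `φ v ≤ d` vertices.

The parts chosen in different rounds are pairwise disjoint (`Packed.union`). A later part `Y` avoids
`v` and `Z`, because these belong to the solution by then, so it cannot cross between `X` and its
complement. Either it misses `X`, or it lies inside `X`; in the second case minimality of `X` forces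
`X ⊆ Y`, hence `v ∈ Y`, which is impossible. Each part contains a vertex whose demand exceeds the
size of the part's boundary, so every feasible set meets every part (`le_card_boundary`). Hence
there are at most `opt` productive rounds, and the solution has at most `d * opt` vertices
(`Packed.card_le`). Each productive round adds a new vertex, so `n` rounds suffice.

Since `Z` has fewer than `d` vertices, a minimal cut is found by trying every source and every tuple
of `d` vertices, about `n ^ (d + 1)` candidates, which is polynomial for fixed `d`.

The running time is proved on actual Turing machines. A small structured language of stack programs
with an exact step count compiles to `TM2` machines. Above it lies a language of actions on vertex
sets (tests for membership and adjacency, insertion, deletion, branching, loops over all vertices)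
in which every program is polynomial by construction. The approximation algorithm is written in the
latter, and its correctness is proved from the set-theoretic meaning of the actions alone. -/

namespace StackProgram

open Function

/-! ### Structured stack programs and their compilation to `TM2` machines -/

section Language

variable {K : Type} [DecidableEq K] {Γ : K → Type}

/-- Structured programs that operate on a family of stacks. -/
inductive Cmd (Γ : K → Type) : Type
  /-- do nothing -/
  | skip
  /-- push a symbol -/
  | push (k : K) (a : Γ k)
  /-- run two programs in sequence -/
  | seq (c₁ c₂ : Cmd Γ)
  /-- pop a symbol and branch on it -/
  | case (k : K) (c : Option (Γ k) → Cmd Γ)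
  /-- keep popping symbols and running the program chosen by the symbol, until the stack is empty
  or a stopping symbol has been popped -/
  | loop (k : K) (halts : Γ k → Bool) (c : Γ k → Cmd Γ)

/-- `Exec c m m' t`: started on the stacks `m`, the program `c` ends with the stacks `m'` after
`t` steps. -/
inductive Exec : Cmd Γ → (∀ k, List (Γ k)) → (∀ k, List (Γ k)) → ℕ → Prop
  | skip (m) : Exec .skip m m 1
  | push (k : K) (a : Γ k) (m) : Exec (.push k a) m (update m k (a :: m k)) 1
  | seq {c₁ c₂ m m' m'' t t'} : Exec c₁ m m' t → Exec c₂ m' m'' t' →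
      Exec (.seq c₁ c₂) m m'' (t + t')
  | case {k c m m' t} : Exec (c (m k).head?) (update m k (m k).tail) m' t →
      Exec (.case k c) m m' (1 + t)
  | loop_nil {k} {halts : Γ k → Bool} {c m} : m k = [] → Exec (.loop k halts c) m m 1
  | loop_exit {k} {halts : Γ k → Bool} {c m a l} : m k = a :: l → halts a = true →
      Exec (.loop k halts c) m (update m k l) 1
  | loop_step {k} {halts : Γ k → Bool} {c m a l m' m'' t t'} : m k = a :: l → halts a = false →
      Exec (c a) (update m k l) m' t → Exec (.loop k halts c) m' m'' t' →
      Exec (.loop k halts c) m m'' (1 + (t + t'))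

/-- The control points of a program. -/
def Lab : Cmd Γ → Type
  | .skip => Unit
  | .push _ _ => Unit
  | .seq c₁ c₂ => Lab c₁ ⊕ Lab c₂
  | .case _ c => Option (Σ o, Lab (c o))
  | .loop _ _ c => Option (Σ a, Lab (c a))

/-- The control point at which a program starts. -/
def entry : (c : Cmd Γ) → Lab c
  | .skip => ()
  | .push _ _ => ()
  | .seq c₁ _ => Sum.inl (entry c₁)
  | .case _ _ => none
  | .loop _ _ _ => none

instance Lab.finite [∀ k, Finite (Γ k)] : (c : Cmd Γ) → Finite (Lab c)
  | .skip => inferInstanceAs (Finite Unit)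
  | .push _ _ => inferInstanceAs (Finite Unit)
  | .seq c₁ c₂ =>
    have := Lab.finite c₁
    have := Lab.finite c₂
    inferInstanceAs (Finite (Lab c₁ ⊕ Lab c₂))
  | .case _ c =>
    have := fun o => Lab.finite (c o)
    inferInstanceAs (Finite (Option (Σ o, Lab (c o))))
  | .loop _ _ c =>
    have := fun a => Lab.finite (c a)
    inferInstanceAs (Finite (Option (Σ a, Lab (c a))))

/-- The statement of a `TM2` machine at each control point of a program; `e` embeds the control
points into the labels of the machine, and `x` is the label to which the program exits. -/
def compile {L : Type} : (c : Cmd Γ) → (Lab c → L) → L → Lab c →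
    Turing.TM2.Stmt Γ L (∀ k, Option (Γ k))
  | .skip, _, x, _ => .goto fun _ => x
  | .push k a, _, x, _ => .push k (fun _ => a) (.goto fun _ => x)
  | .seq c₁ c₂, e, _, .inl l => compile c₁ (fun l => e (.inl l)) (e (.inr (entry c₂))) l
  | .seq _ c₂, e, x, .inr l => compile c₂ (fun l => e (.inr l)) x l
  | .case k c, e, _, none =>
    .pop k (fun v o => update v k o) (.goto fun v => e (some ⟨v k, entry (c (v k))⟩))
  | .case _ c, e, x, some ⟨o, l⟩ => compile (c o) (fun l => e (some ⟨o, l⟩)) x l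
  | .loop k halts c, e, x, none =>
    .pop k (fun v o => update v k o) (.goto fun v =>
      match v k with
      | none => x
      | some a => if halts a then x else e (some ⟨a, entry (c a)⟩))
  | .loop _ _ c, e, _, some ⟨a, l⟩ => compile (c a) (fun l => e (some ⟨a, l⟩)) (e none) l

/-- `t` steps of the machine `M` lead from one configuration to another. -/
def StepsTo {L σ : Type} (M : L → Turing.TM2.Stmt Γ L σ) (t : ℕ) (a b : Turing.TM2.Cfg Γ L σ) :
    Prop :=
  (flip bind (Turing.TM2.step M))^[t] (some a) = some b

theorem StepsTo.trans {L σ : Type} {M : L → Turing.TM2.Stmt Γ L σ} {t t' : ℕ}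
    {a b c : Turing.TM2.Cfg Γ L σ} (h : StepsTo M t a b) (h' : StepsTo M t' b c) :
    StepsTo M (t + t') a c := by
  unfold StepsTo at *
  rw [Nat.add_comm, iterate_add_apply, h, h']

theorem StepsTo.single {L σ : Type} {M : L → Turing.TM2.Stmt Γ L σ} {l : L} {v : σ}
    {m : ∀ k, List (Γ k)} {b : Turing.TM2.Cfg Γ L σ} {s : Turing.TM2.Stmt Γ L σ} (hs : M l = s)
    (h : Turing.TM2.stepAux s v m = b) : StepsTo M 1 ⟨some l, v, m⟩ b := by
  subst hs h
  rfl

/-- A machine that contains a compiled program simulates it. -/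
theorem Exec.stepsTo {c : Cmd Γ} {m m' : ∀ k, List (Γ k)} {t : ℕ} (h : Exec c m m' t) {L : Type}
    (M : L → Turing.TM2.Stmt Γ L (∀ k, Option (Γ k))) (e : Lab c → L) (x : L)
    (hM : ∀ l, M (e l) = compile c e x l) (v : ∀ k, Option (Γ k)) :
    ∃ v', StepsTo M t ⟨some (e (entry c)), v, m⟩ ⟨some x, v', m'⟩ := by
  induction h generalizing x v with
  | skip m =>
    refine ⟨v, ?_⟩
    exact .single (hM _) rfl
  | push k a m =>
    refine ⟨v, ?_⟩
    exact .single (hM _) rfl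
  | seq _ _ ih₁ ih₂ =>
    obtain ⟨v₁, h₁⟩ := ih₁ (fun l => e (.inl l)) (e (.inr (entry _)))
      (fun l => hM _) v
    obtain ⟨v₂, h₂⟩ := ih₂ (fun l => e (.inr l)) x (fun l => hM _) v₁
    exact ⟨v₂, h₁.trans h₂⟩
  | @case k c m m' t _ ih =>
    obtain ⟨v', h'⟩ := ih (fun l => e (some ⟨_, l⟩)) x (fun l => hM _)
      (update v k (m k).head?)
    refine ⟨v', StepsTo.trans ?_ h'⟩
    refine .single (hM _) ?_
    simp only [entry, compile, Turing.TM2.stepAux]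
    rw [update_self]
  | @loop_nil k halts c m hk =>
    refine ⟨update v k none, ?_⟩
    refine .single (hM _) ?_
    simp only [entry, compile, Turing.TM2.stepAux]
    have : update m k [] = m := by rw [← hk, update_eq_self]
    simp [hk, this]
  | @loop_exit k halts c m a l hk hs =>
    refine ⟨update v k (some a), ?_⟩
    refine .single (hM _) ?_
    simp only [entry, compile, Turing.TM2.stepAux]
    simp [hk, hs]
  | @loop_step k halts c m a l m' m'' t t' hk hs _ _ ih₁ ih₂ =>
    -- The body of the loop is compiled with the head of the loop as its exit, so the two
    -- simulations compose.
    obtain ⟨v₁, h₁⟩ := ih₁ (fun l => e (some ⟨a, l⟩)) (e none) (fun l => hM _)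
      (update v k (some a))
    obtain ⟨v₂, h₂⟩ := ih₂ e x hM v₁
    refine ⟨v₂, StepsTo.trans ?_ (h₁.trans h₂)⟩
    refine .single (hM _) ?_
    simp only [entry, compile, Turing.TM2.stepAux]
    simp [hk, hs]

/-- The machine that runs a program and halts. -/
noncomputable def machine [Fintype K] [∀ k, Fintype (Γ k)] (c : Cmd Γ) (k₀ k₁ : K) :
    Turing.FinTM2 where
  K := K
  k₀ := k₀
  k₁ := k₁
  Γ := Γ
  Λ := Option (Lab c)
  main := some (entry c)
  ΛFin := Fintype.ofFinite _
  σ := ∀ k, Option (Γ k)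
  initialState := fun _ => none
  σFin := Fintype.ofFinite _
  m
    -- A halting configuration must carry the initial internal state, so the registers are reset
    -- before halting.
    | none => .load (fun _ _ => none) .halt
    | some l => compile c some none l

/-- A program that computes a function in polynomial time yields a Turing machine that does. -/
noncomputable def polyTimeOfExec [Fintype K] [∀ k, Fintype (Γ k)] {α : Type} (c : Cmd Γ)
    (k₀ k₁ : K) (inp : α → List (Γ k₀)) (out : α → List (Γ k₁)) (p : Polynomial ℕ)
    (h : ∀ a, ∃ t ≤ p.eval (inp a).length,
      Exec c (update (fun _ => []) k₀ (inp a)) (update (fun _ => []) k₁ (out a)) t) :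
    Turing.TM2ComputableInPolyTime inp (id : List (Γ k₁) → List (Γ k₁)) out where
  tm := machine c k₀ k₁
  inputAlphabet := Equiv.refl _
  outputAlphabet := Equiv.refl _
  -- The extra step is the one that resets the registers and halts.
  time := p + 1
  outputsFun a :=
    { steps := (h a).choose + 1
      evals_in_steps := by
        obtain ⟨_, he⟩ := (h a).choose_spec
        obtain ⟨v, hv⟩ := he.stepsTo (machine c k₀ k₁).m some none (fun _ => rfl)
          (fun _ => none)
        have hfin : StepsTo (machine c k₀ k₁).m 1 ⟨some none, v, update (fun _ => []) k₁ (out a)⟩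
            ⟨none, fun _ => none, update (fun _ => []) k₁ (out a)⟩ := rfl
        have key := hv.trans hfin
        have h₀ : Turing.initList (machine c k₀ k₁) ((inp a).map (Equiv.refl _).invFun) =
            ⟨some (some (entry c)), fun _ => none, update (fun _ => []) k₀ (inp a)⟩ := by
          unfold Turing.initList
          congr 1
          funext k
          by_cases hk : k = (machine c k₀ k₁).k₀
          · rw [dif_pos hk]
            cases hk
            exact (List.map_id _).trans (update_self (f := fun _ => []) _ _).symm
          · rw [dif_neg hk]
            exact (update_of_ne (f := fun _ => []) hk _).symm
        have h₁ : Turing.haltList (machine c k₀ k₁) ((out a).map (Equiv.refl _).invFun) =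
            ⟨none, fun _ => none, update (fun _ => []) k₁ (out a)⟩ := by
          unfold Turing.haltList
          congr 1
          funext k
          by_cases hk : k = (machine c k₀ k₁).k₁
          · rw [dif_pos hk]
            cases hk
            exact (List.map_id _).trans (update_self (f := fun _ => []) _ _).symm
          · rw [dif_neg hk]
            exact (update_of_ne (f := fun _ => []) hk _).symm
        erw [h₀]
        exact Eq.trans key (congrArg some h₁.symm)
      steps_le_m := by
        have := (h a).choose_spec.1
        simpa using this }

end Language

end StackProgram

/-! ### Unary arithmetic and array access on binary stacks -/

namespace StackProgram

open Function

/-- The names of the binary stacks of a machine that works with loop variables `ι` and vertex sets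
`κ`. -/
inductive Stk (ι κ : Type) : Type
  | output
  | size
  | matrix
  | array (a : κ)
  | var (x : ι)
  | result
  | counter
  | scratch
  | scratch₂
  deriving DecidableEq, Fintype

/-- The stack alphabets: the input stack `none` carries the alphabet `α`, all others are binary. -/
abbrev Letter (ι κ α : Type) : Option (Stk ι κ) → Type
  | none => α
  | some _ => Bool

section Run

variable {ι κ α : Type}

/-- The contents of all stacks, given those of the input stack and the binary stacks. -/
def lift (inp : List α) (m : Stk ι κ → List Bool) : ∀ k, List (Letter ι κ α k)
  | none => inp
  | some b => m b

variable [DecidableEq ι] [DecidableEq κ]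

theorem update_lift_some (inp : List α) (m : Stk ι κ → List Bool) (b : Stk ι κ) (l : List Bool) :
    update (lift inp m) (some b) l = lift inp (update m b l) := by
  funext k
  rcases k with _ | k
  · rfl
  · by_cases h : k = b
    · subst h
      simp [lift]
    · simp [lift, h]

theorem update_lift_none (inp l : List α) (m : Stk ι κ → List Bool) :
    update (lift inp m) none l = lift l m := by
  funext k
  rcases k with _ | k <;> rfl

/-- With an empty input stack, the program `c` leads from `m` to `m'` in at most `T` steps. -/
def Run (c : Cmd (Letter ι κ α)) (m m' : Stk ι κ → List Bool) (T : ℕ) : Prop :=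
  ∃ t ≤ T, Exec c (lift [] m) (lift [] m') t

variable {c c₁ c₂ : Cmd (Letter ι κ α)} {m m' m'' : Stk ι κ → List Bool} {T T' : ℕ}

theorem Run.mono (h : Run c m m' T) (hT : T ≤ T') : Run c m m' T' := by
  obtain ⟨t, ht, h⟩ := h
  exact ⟨t, ht.trans hT, h⟩

theorem Run.congr {m₁ m₂ : Stk ι κ → List Bool} (h : Run c m m' T) (h₁ : m = m₁) (h₂ : m' = m₂) :
    Run c m₁ m₂ T := by
  rwa [← h₁, ← h₂]

theorem Run.skip : Run (.skip : Cmd (Letter ι κ α)) m m 1 := ⟨1, le_rfl, .skip _⟩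

theorem Run.push (b : Stk ι κ) (x : Bool) :
    Run (.push (some b) x : Cmd (Letter ι κ α)) m (update m b (x :: m b)) 1 := by
  refine ⟨1, le_rfl, ?_⟩
  rw [← update_lift_some]
  exact .push (Γ := Letter ι κ α) (some b) x _

theorem Run.seq (h₁ : Run c₁ m m' T) (h₂ : Run c₂ m' m'' T') : Run (.seq c₁ c₂) m m'' (T + T') := by
  obtain ⟨t, ht, h₁⟩ := h₁
  obtain ⟨t', ht', h₂⟩ := h₂
  exact ⟨_, add_le_add ht ht', .seq h₁ h₂⟩

theorem Run.case {b : Stk ι κ} {c : Option Bool → Cmd (Letter ι κ α)}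
    (h : Run (c (m b).head?) (update m b (m b).tail) m' T) :
    Run (.case (some b) c) m m' (1 + T) := by
  obtain ⟨t, ht, h⟩ := h
  rw [← update_lift_some] at h
  exact ⟨_, Nat.add_le_add_left ht 1, .case (k := some b) h⟩

/-- Keep popping `true` and running `c`, until something else has been popped. -/
def whileTop (b : Stk ι κ) (c : Cmd (Letter ι κ α)) : Cmd (Letter ι κ α) :=
  .loop (some b) (fun x => !x) (fun _ => c)

theorem Run.whileTop_nil {b : Stk ι κ} (h : m b = []) : Run (whileTop b c) m m 1 :=
  ⟨1, le_rfl, .loop_nil (k := some b) h⟩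

theorem Run.whileTop_false {b : Stk ι κ} {l : List Bool} (h : m b = false :: l) :
    Run (whileTop b c) m (update m b l) 1 := by
  refine ⟨1, le_rfl, ?_⟩
  rw [← update_lift_some]
  exact .loop_exit (k := some b) h rfl

theorem Run.whileTop_true {b : Stk ι κ} {l : List Bool} (h : m b = true :: l)
    (h₁ : Run c (update m b l) m' T) (h₂ : Run (whileTop b c) m' m'' T') :
    Run (whileTop b c) m m'' (1 + (T + T')) := by
  obtain ⟨t, ht, h₁⟩ := h₁
  obtain ⟨t', ht', h₂⟩ := h₂
  rw [← update_lift_some] at h₁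
  exact ⟨_, by omega, .loop_step (k := some b) h rfl h₁ h₂⟩

/-- Move the contents of a stack to another one, which reverses them. -/
def pour (a b : Stk ι κ) : Cmd (Letter ι κ α) :=
  .loop (some a) (fun _ => false) (fun x => .push (some b) x)

theorem Run.pour {a b : Stk ι κ} (hab : a ≠ b) :
    Run (pour a b : Cmd (Letter ι κ α)) m (update (update m b ((m a).reverse ++ m b)) a [])
      (2 * (m a).length + 1) := by
  generalize hl : m a = l
  induction l generalizing m with
  | nil =>
    have : update (update m b ([].reverse ++ m b)) a [] = m := by
      simp only [List.reverse_nil, List.nil_append, update_eq_self]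
      rw [← hl, update_eq_self]
    rw [this]
    exact ⟨1, le_rfl, .loop_nil (k := some a) hl⟩
  | cons x l ih =>
    obtain ⟨t, ht, h⟩ := ih (m := update (update m a l) b (x :: m b)) (by simp [hab])
    have hp : Exec (.push (some b) x : Cmd (Letter ι κ α)) (update (lift [] m) (some a) l)
        (lift [] (update (update m a l) b (x :: m b))) 1 := by
      have h₁ := Exec.push (Γ := Letter ι κ α) (some b) x (lift [] (update m a l))
      have h₂ : lift ([] : List α) (update m a l) (some b) = m b := by
        simp [lift, hab.symm]
      rw [h₂, update_lift_some] at h₁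
      rwa [update_lift_some]
    have := Exec.loop_step (Γ := Letter ι κ α) (k := some a) (halts := fun _ => false) (c := fun x => .push (some b) x)
      (m := lift [] m) (a := x) (l := l) hl rfl hp h
    refine ⟨1 + (1 + t), ?_, ?_⟩
    rotate_left
    · refine (congrArg (fun m' => Exec (pour a b) (lift [] m) (lift [] m') (1 + (1 + t))) ?_).mp this
      funext k
      simp only [update_apply]
      split_ifs <;> simp_all
    · simp only [List.length_cons]
      omega

/-- Push the height of the stack `x` above its uppermost `false` to the stack `c`, in unary. -/
def copyTo (x c : Stk ι κ) : Cmd (Letter ι κ α) :=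
  .seq (whileTop x (.push (some .scratch) true)) <| .seq (.push (some x) false) <|
    whileTop .scratch (.seq (.push (some x) true) (.push (some c) true))

theorem Run.whileTop_push {x t : Stk ι κ} (hxt : x ≠ t) {i : ℕ} {l : List Bool}
    (h : m x = List.replicate i true ++ false :: l) :
    Run (whileTop x (.push (some t) true) : Cmd (Letter ι κ α)) m
      (update (update m x l) t (List.replicate i true ++ m t)) (2 * i + 1) := by
  induction i generalizing m with
  | zero =>
    refine (Run.whileTop_false (b := x) (l := l) (by simpa using h)).congr rfl ?_
    funext k
    simp only [update_apply]
    split_ifs <;> simp_all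
  | succ i ih =>
    refine (Run.whileTop_true (by simpa [List.replicate_succ] using h) (.push t true)
      (?_ : Run _ _ _ (2 * i + 1))).mono (by omega)
    refine (ih ?_).congr rfl ?_
    rotate_left
    · funext k
      simp only [update_apply]
      split_ifs <;> simp_all [List.replicate_succ']
    · simp [hxt]

theorem Run.whileTop_push_push {t x y : Stk ι κ} (htx : t ≠ x) (hty : t ≠ y) (hxy : x ≠ y) {i : ℕ}
    (h : m t = List.replicate i true) :
    Run (whileTop t (.seq (.push (some x) true) (.push (some y) true)) : Cmd (Letter ι κ α)) m
      (update (update (update m t []) x (List.replicate i true ++ m x)) y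
        (List.replicate i true ++ m y)) (3 * i + 1) := by
  induction i generalizing m with
  | zero =>
    refine (Run.whileTop_nil (by simpa using h)).congr rfl ?_
    funext k
    simp only [update_apply]
    split_ifs <;> simp_all
  | succ i ih =>
    refine (Run.whileTop_true (by simpa [List.replicate_succ] using h)
      ((Run.push x true).seq (.push y true)) (?_ : Run _ _ _ (3 * i + 1))).mono (by omega)
    refine (ih ?_).congr rfl ?_
    rotate_left
    · funext k
      simp only [update_apply]
      split_ifs <;> simp_all [List.replicate_succ']
    · simp [htx, hty]

/-- The number is moved to the scratch stack and then back, with a second copy on the way. Emptying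
`x` also consumes the `false` that delimits the number, which is why it is pushed again. What lies
below the delimiter is never touched. -/
theorem Run.copy {x c : Stk ι κ} (hxc : x ≠ c) (hx : x ≠ .scratch) (hc : c ≠ .scratch) {i : ℕ}
    {l : List Bool} (h : m x = List.replicate i true ++ false :: l) (hs : m .scratch = []) :
    Run (copyTo x c : Cmd (Letter ι κ α)) m (update m c (List.replicate i true ++ m c)) (5 * i + 3) := by
  refine ((Run.whileTop_push hx h).seq ((Run.push x false).seq
    (T' := 3 * i + 1) ?_)).mono (by omega)
  refine (Run.whileTop_push_push hx.symm hc.symm hxc (i := i) ?_).congr rfl ?_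
  rotate_left
  · funext k
    simp only [update_apply]
    split_ifs <;> simp_all
  · simp [hx.symm, hs]

/-- Move as many symbols from the stack `a` to the scratch stack as the counter says. -/
def seek (a : Stk ι κ) : Cmd (Letter ι κ α) :=
  whileTop .counter (.case (some a) fun
    | none => .skip
    | some b => .push (some .scratch) b)

theorem Run.seek {a : Stk ι κ} (hac : a ≠ .counter) (has : a ≠ .scratch) {l l' : List Bool}
    (hl : m a = l ++ l') (hc : m .counter = List.replicate l.length true) :
    Run (seek a : Cmd (Letter ι κ α)) m
      (update (update (update m .counter []) a l') .scratch (l.reverse ++ m .scratch))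
      (3 * l.length + 1) := by
  induction l generalizing m with
  | nil =>
    refine (Run.whileTop_nil (by simpa using hc)).congr rfl ?_
    funext k
    simp only [update_apply]
    split_ifs <;> simp_all
  | cons x l ih =>
    refine (Run.whileTop_true (l := List.replicate l.length true)
      (by simpa [List.replicate_succ] using hc)
      (.case (m' := update (update (update m .counter (List.replicate l.length true)) a (l ++ l'))
        .scratch (x :: m .scratch)) (T := 1) ?_) (?_ : Run _ _ _ (3 * l.length + 1))).mono
      (by rw [List.length_cons]; omega)
    · simp only [update_of_ne hac, hl, List.cons_append, List.head?_cons, List.tail_cons]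
      refine (Run.push .scratch x).congr rfl ?_
      simp [has.symm]
    · refine (ih ?_ ?_).congr rfl ?_
      rotate_right
      · funext k
        simp only [update_apply]
        split_ifs <;> simp_all
      · simp [has]
      · simp [hac.symm]

/-- Push the entry of the stack `a` at the position given by the counter to the result stack. -/
def readAt (a : Stk ι κ) : Cmd (Letter ι κ α) :=
  .seq (seek a) <| .seq (.case (some a) fun
    | none => .skip
    | some b => .seq (.push (some a) b) (.push (some .result) b)) (pour .scratch a)

/-- Replace the entry of the stack `a` at the position given by the counter. -/
def writeAt (a : Stk ι κ) (b : Bool) : Cmd (Letter ι κ α) :=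
  .seq (seek a) <| .seq (.case (some a) fun _ => .push (some a) b) (pour .scratch a)

/-- Seeking leaves the first `i` entries reversed on the scratch stack, and pouring reverses them
once more, so the array is restored. The entry itself is pushed back before the pouring. -/
theorem Run.readAt {a : Stk ι κ} (hac : a ≠ .counter) (has : a ≠ .scratch) (har : a ≠ .result)
    {i : ℕ} {b : Bool} (hb : (m a)[i]? = some b) (hc : m .counter = List.replicate i true)
    (hs : m .scratch = []) :
    Run (readAt a : Cmd (Letter ι κ α)) m
      (update (update m .counter []) .result (b :: m .result)) (5 * i + 5) := by
  obtain ⟨hi, rfl⟩ := List.getElem?_eq_some_iff.1 hb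
  clear hb
  have hl : m a = (m a).take i ++ (m a)[i] :: (m a).drop (i + 1) := by simp
  have hlen : ((m a).take i).length = i := by simp [hi.le]
  refine (((Run.seek hac has hl (by rw [hlen, hc])).seq
    ((Run.case (T := 2) (m' := update (update (update (update m .counter []) a
      ((m a).drop i)) .scratch ((m a).take i).reverse) .result ((m a)[i] :: m .result)) ?_).seq
      ((Run.pour (Ne.symm has)).mono (T' := 2 * i + 1) ?_))).mono (T' := 5 * i + 5) (by omega)).congr rfl ?_
  · simp only [update_of_ne has, update_self, List.head?_cons, List.tail_cons]
    refine ((Run.push a (m a)[i]).seq (Run.push .result (m a)[i])).congr rfl ?_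
    funext k
    rcases eq_or_ne k a with rfl | hk
    · simp [has, har]
    · simp only [update_apply]
      split_ifs <;> simp_all
  · simp [hlen]
  · funext k
    rcases eq_or_ne k a with rfl | hk
    · simp [hac, has, har]
    · simp only [update_apply]
      split_ifs <;> simp_all

theorem Run.writeAt {a : Stk ι κ} (hac : a ≠ .counter) (has : a ≠ .scratch) {i : ℕ}
    (hi : i < (m a).length) (hc : m .counter = List.replicate i true) (hs : m .scratch = [])
    (b : Bool) :
    Run (writeAt a b : Cmd (Letter ι κ α)) m
      (update (update m .counter []) a ((m a).set i b)) (5 * i + 4) := by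
  have hl : m a = (m a).take i ++ (m a)[i] :: (m a).drop (i + 1) := by simp
  have hlen : ((m a).take i).length = i := by simp [hi.le]
  refine (((Run.seek hac has hl (by rw [hlen, hc])).seq
    ((Run.case (T := 1) (m' := update (update (update m .counter [])
      .scratch ((m a).take i).reverse) a (b :: (m a).drop (i + 1))) ?_).seq
      ((Run.pour (Ne.symm has)).mono (T' := 2 * i + 1) ?_))).mono (T' := 5 * i + 4) (by omega)).congr rfl ?_
  · simp only [update_of_ne has, update_self, List.tail_cons]
    refine (Run.push a b).congr rfl ?_
    funext k
    simp only [update_apply]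
    split_ifs <;> simp_all
  · simp [has.symm, hlen]
  · funext k
    simp only [update_apply]
    split_ifs <;> simp_all [List.set_eq_take_append_cons_drop]

/-- Push `i * n + j` to the counter, where `i`, `j` and `n` are the heights of `x`, `y` and the
size stack. -/
def matrixIndex (x y : Stk ι κ) : Cmd (Letter ι κ α) :=
  .seq (.push (some .scratch₂) false) <|
  .seq (whileTop x (.seq (.push (some .scratch₂) true) (copyTo .size .counter))) <|
  .seq (.push (some x) false) <|
  .seq (whileTop .scratch₂ (.push (some x) true)) (copyTo y .counter)

theorem Run.whileTop_copy {x : Stk ι κ} (hx₁ : x ≠ .scratch) (hx₂ : x ≠ .scratch₂)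
    (hx₃ : x ≠ .counter) (hx₄ : x ≠ .size) {i n : ℕ} {l l' : List Bool}
    (h : m x = List.replicate i true ++ false :: l)
    (hn : m .size = List.replicate n true ++ false :: l') (hs : m .scratch = []) :
    Run (whileTop x (.seq (.push (some .scratch₂) true) (copyTo .size .counter)) : Cmd (Letter ι κ α)) m
      (update (update (update m x l) .scratch₂ (List.replicate i true ++ m .scratch₂)) .counter
        (List.replicate (i * n) true ++ m .counter)) (i * (5 * n + 5) + 1) := by
  induction i generalizing m with
  | zero =>
    refine ((Run.whileTop_false (b := x) (l := l) (by simpa using h)).mono (by omega)).congr rfl ?_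
    funext k
    simp only [update_apply]
    split_ifs <;> simp_all
  | succ i ih =>
    refine (Run.whileTop_true (by simpa [List.replicate_succ] using h)
      ((Run.push .scratch₂ true).seq (Run.copy (i := n) (l := l') (by simp) (by simp) (by simp)
        ?_ ?_)) (?_ : Run _ _ _ (i * (5 * n + 5) + 1))).mono (by grind)
    · simp [hx₄.symm, hn]
    · simp [hx₁.symm, hs]
    · refine (ih ?_ ?_ ?_).congr rfl ?_
      rotate_right
      · funext k
        simp only [update_apply]
        split_ifs <;> simp_all [List.replicate_succ', Nat.succ_mul, ← List.replicate_append_replicate]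
      · simp [hx₂, hx₃]
      · simp [hx₄.symm, hn]
      · simp [hx₁.symm, hs]

/-- Each unit of `x` contributes one copy of the size to the counter, which gives the product.
Copying occupies the first scratch stack, so the units of `x` are saved on the second one, above a
marker. As `x` is restored before `y` is copied, the two may coincide. -/
theorem Run.matrixIndex {x y : Stk ι κ} (hx₁ : x ≠ .scratch) (hx₂ : x ≠ .scratch₂)
    (hx₃ : x ≠ .counter) (hx₄ : x ≠ .size) (hy₁ : y ≠ .scratch)
    (hy₃ : y ≠ .counter) {i j n : ℕ} {l l' l'' : List Bool}
    (hx : m x = List.replicate i true ++ false :: l)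
    (hy : m y = List.replicate j true ++ false :: l'')
    (hn : m .size = List.replicate n true ++ false :: l') (hs : m .scratch = [])
    (hs₂ : m .scratch₂ = []) (hc : m .counter = []) :
    Run (matrixIndex x y : Cmd (Letter ι κ α)) m
      (update m .counter (List.replicate (i * n + j) true)) (i * (5 * n + 7) + 5 * j + 7) := by
  have hm : update (update m .counter (List.replicate (i * n) true)) .counter
      (List.replicate j true ++ List.replicate (i * n) true) =
      update m .counter (List.replicate (i * n + j) true) := by
    rw [update_idem, List.replicate_append_replicate, Nat.add_comm]
  refine (((Run.push .scratch₂ false).seq ((Run.whileTop_copy hx₁ hx₂ hx₃ hx₄ (i := i) (n := n)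
    (l := l) (l' := l') ?_ ?_ ?_).seq ((Run.push x false).seq
      ((Run.whileTop_push hx₂.symm (i := i) (l := []) ?_).seq
        ((Run.copy (i := j) (l := l'') hy₃ hy₁ (by simp) ?_ ?_).congr ?_ hm))))).mono
          (by grind))
  · simp [hx₂, hx]
  · simp [hn]
  · simp [hs]
  · simp [hs₂, hx₂.symm]
  · simp [hy₃, hy]
  · simp [hs]
  · funext k
    simp only [update_apply]
    split_ifs <;> simp_all

end Run

end StackProgram

/-! ### Actions and tests on vertex sets that run in polynomial time -/

namespace StackProgram

open Function

noncomputable section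

variable {ι κ : Type} (α : Type)

/-- The contents of the binary stacks that represent a graph `G` on `n` vertices, the values `ρ` of
the loop variables and the vertex sets `s`; `rest` lies below the values of the loop variables and
`R` is on the result stack. Sets and vertices are represented in reverse order. -/
def config {n : ℕ} (G : SimpleGraph (Fin n)) [DecidableRel G.Adj] (ρ : ι → Fin n)
    (s : κ → Finset (Fin n)) (rest : ι → List Bool) (R : List Bool) : Stk ι κ → List Bool
  | .output => []
  | .size => List.replicate n true ++ [false]
  | .matrix => ((List.finRange n ×ˢ List.finRange n).map fun p => decide (G.Adj p.1 p.2)).reverse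
  | .array a => ((List.finRange n).map fun v => decide (v ∈ s a)).reverse
  | .var x => List.replicate (n - 1 - ρ x) true ++ false :: rest x
  | .result => R
  | .counter => []
  | .scratch => []
  | .scratch₂ => []

section

variable {n : ℕ} (G : SimpleGraph (Fin n)) [DecidableRel G.Adj] (ρ : ι → Fin n)
  (s : κ → Finset (Fin n)) (rest : ι → List Bool) (R : List Bool)

/-- The depth of the entry for `v` is exactly the unary number that represents a variable with value
`v`, so a copied variable serves directly as an address. -/
theorem getElem?_config_array (a : κ) (v : Fin n) :
    (config G ρ s rest R (.array a))[n - 1 - (v : ℕ)]? = some (decide (v ∈ s a)) := by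
  have hv := v.2
  have : n - 1 - (n - 1 - (v : ℕ)) = v := by omega
  rw [List.getElem?_eq_some_iff]
  refine ⟨by simp [config]; omega, by simp [config, List.getElem_reverse, this]⟩

theorem set_config_array (a : κ) (v : Fin n) (t : Finset (Fin n)) (b : Bool)
    (ht : ∀ w, decide (w ∈ t) = if w = v then b else decide (w ∈ s a)) :
    (config G ρ s rest R (.array a)).set (n - 1 - v) b =
      ((List.finRange n).map fun v => decide (v ∈ t)).reverse := by
  have hv := v.2
  refine List.ext_getElem (by simp [config]) fun i hi hi' => ?_
  have hi : i < n := by simpa [config] using hi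
  rw [List.getElem_set]
  simp only [config, List.getElem_reverse, List.getElem_map, List.length_map, ht,
    List.length_finRange, List.getElem_finRange]
  have : n - 1 - v = i ↔ (Fin.cast (by simp) (⟨n - 1 - i, by simp; omega⟩ :
      Fin (List.finRange n).length) : Fin n) = v := by
    rw [Fin.ext_iff]
    simp
    omega
  simp only [this]

end

theorem getElem?_product {β γ : Type*} (l : List β) (l' : List γ) {i j : ℕ} {b : β} {c : γ}
    (hb : l[i]? = some b) (hc : l'[j]? = some c) : (l ×ˢ l')[i * l'.length + j]? = some (b, c) := by
  induction l generalizing i with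
  | nil => simp at hb
  | cons a l ih =>
    rw [List.product_cons]
    rcases i with _ | i
    · have hj : j < l'.length := (List.getElem?_eq_some_iff.1 hc).1
      obtain rfl : a = b := by simpa using hb
      rw [List.getElem?_append_left (by simpa using hj)]
      simp [hc]
    · rw [List.getElem?_append_right (by simp [Nat.succ_mul]; omega), ← ih (by simpa using hb)]
      congr 1
      simp [Nat.succ_mul]
      omega

/-- Reversing a row-major list of length `n * n` sends the index `u * n + v` to `n * n - 1 - (u * n
+ v) = (n - 1 - u) * n + (n - 1 - v)`. Hence the row-major formula remains valid for the
complemented values that the variables store. -/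
theorem getElem?_config_matrix {n : ℕ} (G : SimpleGraph (Fin n)) [DecidableRel G.Adj] (ρ : ι → Fin n)
    (s : κ → Finset (Fin n)) (rest : ι → List Bool) (R : List Bool) (u v : Fin n) :
    (config G ρ s rest R .matrix)[(n - 1 - (u : ℕ)) * n + (n - 1 - v)]? =
      some (decide (G.Adj u v)) := by
  obtain ⟨k, hk⟩ := Nat.exists_eq_add_of_lt u.2
  obtain ⟨j, hj⟩ := Nat.exists_eq_add_of_lt v.2
  have h₁ : n - 1 - (u : ℕ) = k := by omega
  have h₂ : n - 1 - (v : ℕ) = j := by omega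
  have h₃ : n * n = u * n + k * n + n := by
    nth_rewrite 1 [hk]
    ring
  have hlt : k * n + j < n * n := by rw [h₃]; omega
  have h₄ : n * n - 1 - (k * n + j) = u * n + v := by
    rw [h₃]
    omega
  have h₅ := getElem?_product (List.finRange n) (List.finRange n) (i := u) (j := v) (b := u) (c := v)
    (by simp) (by simp)
  have hlen : (List.finRange n ×ˢ List.finRange n).length = n * n := by
    simp [List.length_product]
  rw [h₁, h₂, config, List.getElem?_reverse (by rw [List.length_map, hlen]; exact hlt),
    List.getElem?_map, List.length_map, hlen, h₄]
  rw [List.length_finRange] at h₅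
  rw [h₅]
  rfl

variable [DecidableEq ι] [DecidableEq κ]

/-- Transformations of a family of vertex sets, which may depend on a graph and loop variables. -/
abbrev Action (ι κ : Type) : Type :=
  ∀ n, SimpleGraph (Fin n) → (ι → Fin n) → (κ → Finset (Fin n)) → κ → Finset (Fin n)

/-- Properties of a family of vertex sets, which may depend on a graph and loop variables. -/
abbrev Test (ι κ : Type) : Type :=
  ∀ n, SimpleGraph (Fin n) → (ι → Fin n) → (κ → Finset (Fin n)) → Prop

open Classical in
/-- The action is carried out by a program in polynomial time. -/
def Action.IsPoly (f : Action ι κ) : Prop :=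
  ∃ (c : Cmd (Letter ι κ α)) (p : Polynomial ℕ), ∀ n (G : SimpleGraph (Fin n)) ρ s rest R,
    Run c (config G ρ s rest R) (config G ρ (f n G ρ s) rest R) (p.eval n)

open Classical in
/-- The property is decided by a program in polynomial time. -/
def Test.IsPoly (P : Test ι κ) : Prop :=
  ∃ (c : Cmd (Letter ι κ α)) (p : Polynomial ℕ), ∀ n (G : SimpleGraph (Fin n)) ρ s rest R,
    Run c (config G ρ s rest R) (config G ρ s rest (decide (P n G ρ s) :: R)) (p.eval n)

namespace Action

/-- Do nothing. -/
def skip : Action ι κ := fun _ _ _ s => s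

/-- Do `f`, then `g`. -/
def seq (f g : Action ι κ) : Action ι κ := fun n G ρ s => g n G ρ (f n G ρ s)

open Classical in
/-- Do `f` if `P` holds. -/
def when (P : Test ι κ) (f : Action ι κ) : Action ι κ :=
  fun n G ρ s => if P n G ρ s then f n G ρ s else s

/-- Do `f` for all values of the variable `x`. -/
def forEach (x : ι) (f : Action ι κ) : Action ι κ :=
  fun n G ρ s => (List.finRange n).foldl (fun s i => f n G (update ρ x i) s) s

/-- Insert `x` into the set `a`. -/
def insert (a : κ) (x : ι) : Action ι κ := fun _ _ ρ s => update s a (Insert.insert (ρ x) (s a))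

/-- Remove `x` from the set `a`. -/
def erase (a : κ) (x : ι) : Action ι κ := fun _ _ ρ s => update s a ((s a).erase (ρ x))

end Action

namespace Test

/-- `x` belongs to the set `a`. -/
def mem (a : κ) (x : ι) : Test ι κ := fun _ _ ρ s => ρ x ∈ s a

/-- `x` and `y` are adjacent. -/
def adj (x y : ι) : Test ι κ := fun _ G ρ _ => G.Adj (ρ x) (ρ y)

/-- Negation. -/
def not (P : Test ι κ) : Test ι κ := fun n G ρ s => ¬ P n G ρ s

/-- Conjunction. -/
def and (P Q : Test ι κ) : Test ι κ := fun n G ρ s => P n G ρ s ∧ Q n G ρ s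

end Test

variable {α}

theorem Action.IsPoly.skip : (Action.skip : Action ι κ).IsPoly α :=
  ⟨.skip, 1, fun n G ρ s rest R => by simpa [Action.skip] using Run.skip⟩

theorem Action.IsPoly.seq {f g : Action ι κ} (hf : f.IsPoly α) (hg : g.IsPoly α) :
    (f.seq g).IsPoly α := by
  obtain ⟨c, p, hc⟩ := hf
  obtain ⟨c', p', hc'⟩ := hg
  refine ⟨.seq c c', p + p', fun n G ρ s rest R => ?_⟩
  rw [Polynomial.eval_add]
  exact (hc n G ρ s rest R).seq (hc' n G ρ _ rest R)

section

variable {n : ℕ} (G : SimpleGraph (Fin n)) [DecidableRel G.Adj] (ρ : ι → Fin n)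
  (s : κ → Finset (Fin n)) (rest : ι → List Bool) (R : List Bool)

theorem update_config_result (R' : List Bool) :
    update (config G ρ s rest R) .result R' = config G ρ s rest R' := by
  funext k
  cases k <;> simp [config]

theorem update_config_array (a : κ) (t : Finset (Fin n)) :
    update (config G ρ s rest R) (.array a)
      ((List.finRange n).map fun v => decide (v ∈ t)).reverse =
      config G ρ (update s a t) rest R := by
  funext k
  cases k with
  | array b =>
    by_cases h : b = a
    · subst h
      simp [config]
    · simp [config, h]
  | _ => simp [config]

theorem update_config_var (x : ι) (i : Fin n) (l : List Bool) :
    update (config G ρ s rest R) (.var x) (List.replicate (n - 1 - i) true ++ false :: l) =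
      config G (update ρ x i) s (update rest x l) R := by
  funext k
  cases k with
  | var y =>
    by_cases h : y = x
    · subst h
      simp [config]
    · simp [config, h]
  | _ => simp [config]

theorem update_config_counter :
    update (config G ρ s rest R) .counter [] = config G ρ s rest R := by
  funext k
  cases k <;> simp [config]

end

theorem Test.IsPoly.mem (a : κ) (x : ι) : (Test.mem a x).IsPoly α := by
  refine ⟨.seq (copyTo (.var x) .counter) (readAt (.array a)), 10 * .X + 8,
    fun n G ρ s rest R => ?_⟩
  have hx := (ρ x).2
  refine (((Run.copy (i := n - 1 - ρ x) (l := rest x) (by simp) (by simp) (by simp) (by simp [config])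
    (by simp [config])).seq (Run.readAt (i := n - 1 - ρ x) (b := decide (ρ x ∈ s a)) (by simp)
      (by simp) (by simp) ?_ (by simp [config]) (by simp [config]))).mono ?_).congr rfl ?_
  · rw [update_of_ne (by simp), getElem?_config_array]
  · simp
    omega
  · simp only [update_idem, update_config_counter]
    rw [update_of_ne (by simp), update_config_result]
    congr 2
    exact decide_eq_decide.2 Iff.rfl

theorem Test.IsPoly.adj (x y : ι) : (Test.adj x y : Test ι κ).IsPoly α := by
  refine ⟨.seq (matrixIndex (.var x) (.var y)) (readAt .matrix),
    .X * (5 * .X + 7) + 5 * .X + 7 + (5 * (.X * .X + .X) + 5), fun n G ρ s rest R => ?_⟩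
  classical
  refine (((Run.matrixIndex (i := n - 1 - ρ x) (j := n - 1 - ρ y) (n := n) (l := rest x) (l' := [])
    (l'' := rest y) (by simp) (by simp) (by simp) (by simp) (by simp) (by simp)
    (by simp [config]) (by simp [config]) (by simp [config]) (by simp [config])
    (by simp [config]) (by simp [config])).seq
      (Run.readAt (i := (n - 1 - ρ x) * n + (n - 1 - ρ y)) (b := decide (G.Adj (ρ x) (ρ y)))
      (by simp) (by simp) (by simp) ?_ (by simp) (by simp [config]))).mono ?_).congr rfl ?_
  · rw [update_of_ne (by simp), getElem?_config_matrix]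
  · simp only [Polynomial.eval_add, Polynomial.eval_mul, Polynomial.eval_X, Polynomial.eval_ofNat]
    have h₁ : n - 1 - (ρ x : ℕ) ≤ n := by omega
    have h₂ : n - 1 - (ρ y : ℕ) ≤ n := by omega
    gcongr
  · simp only [update_idem, update_config_counter]
    rw [update_of_ne (by simp), update_config_result]
    congr! 2

theorem Test.IsPoly.not {P : Test ι κ} (hP : P.IsPoly α) : P.not.IsPoly α := by
  obtain ⟨c, p, hc⟩ := hP
  refine ⟨.seq c (.case (some .result) fun o => .push (some .result) (o != some true)), p + 2,
    fun n G ρ s rest R => ?_⟩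
  refine (((hc n G ρ s rest R).seq (Run.case (Run.push _ _))).mono ?_).congr rfl ?_
  · simp
  · simp only [update_config_result]
    simp only [config, List.head?_cons, List.tail_cons, Test.not]
    congr 1
    by_cases h : P n G ρ s <;> simp [h]

/-- Tests work above arbitrary contents of the result stack, so the bit of `P` can wait there while
`Q` is evaluated. -/
theorem Test.IsPoly.and {P Q : Test ι κ} (hP : P.IsPoly α) (hQ : Q.IsPoly α) :
    (P.and Q).IsPoly α := by
  obtain ⟨c, p, hc⟩ := hP
  obtain ⟨c', p', hc'⟩ := hQ
  refine ⟨.seq c <| .seq c' <| (.case (some .result) fun o => .case (some .result) fun o' =>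
    .push (some .result) (o == some true && o' == some true)), p + p' + 3,
    fun n G ρ s rest R => ?_⟩
  refine (((hc n G ρ s rest R).seq ((hc' n G ρ s rest _).seq
    (Run.case (Run.case (Run.push _ _))))).mono ?_).congr rfl ?_
  · simp
    omega
  · simp only [update_config_result]
    simp only [config, List.head?_cons, List.tail_cons, Test.and]
    congr 1
    by_cases h : P n G ρ s <;> by_cases h' : Q n G ρ s <;> simp [h, h']

theorem Action.IsPoly.when {P : Test ι κ} {f : Action ι κ} (hP : P.IsPoly α) (hf : f.IsPoly α) :
    (Action.when P f).IsPoly α := by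
  obtain ⟨c, p, hc⟩ := hP
  obtain ⟨c', p', hc'⟩ := hf
  refine ⟨.seq c (.case (some .result) fun o => if o = some true then c' else .skip), p + p' + 2,
    fun n G ρ s rest R => ?_⟩
  refine ((hc n G ρ s rest R).seq (Run.case (T := p'.eval n + 1) ?_)).mono ?_
  · rw [update_config_result]
    by_cases h : P n G ρ s
    · simpa [config, Action.when, h] using (hc' n G ρ s rest R).mono (Nat.le_succ _)
    · simpa [config, Action.when, h] using Run.skip.mono (Nat.le_add_left _ _)
  · simp
    omega

theorem Action.IsPoly.insert (a : κ) (x : ι) : (Action.insert a x).IsPoly α := by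
  refine ⟨.seq (copyTo (.var x) .counter) (writeAt (.array a) true), 10 * .X + 7,
    fun n G ρ s rest R => ?_⟩
  classical
  have hx := (ρ x).2
  refine (((Run.copy (i := n - 1 - ρ x) (l := rest x) (by simp) (by simp) (by simp) (by simp [config])
    (by simp [config])).seq (Run.writeAt (i := n - 1 - ρ x) (by simp) (by simp) ?_
      (by simp [config]) (by simp [config]) true)).mono ?_).congr rfl ?_
  · simp [config]
    omega
  · simp
    omega
  · simp only [update_idem, update_config_counter]
    rw [Action.insert, ← update_config_array]
    congr 1
    rw [update_of_ne (by simp)]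
    refine set_config_array G ρ s rest R a (ρ x) _ _ fun w => ?_
    by_cases h : w = ρ x <;> simp [h]

theorem Action.IsPoly.erase (a : κ) (x : ι) : (Action.erase a x).IsPoly α := by
  refine ⟨.seq (copyTo (.var x) .counter) (writeAt (.array a) false), 10 * .X + 7,
    fun n G ρ s rest R => ?_⟩
  classical
  have hx := (ρ x).2
  refine (((Run.copy (i := n - 1 - ρ x) (l := rest x) (by simp) (by simp) (by simp) (by simp [config])
    (by simp [config])).seq (Run.writeAt (i := n - 1 - ρ x) (by simp) (by simp) ?_
      (by simp [config]) (by simp [config]) false)).mono ?_).congr rfl ?_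
  · simp [config]
    omega
  · simp
    omega
  · simp only [update_idem, update_config_counter]
    rw [Action.erase, ← update_config_array]
    congr 1
    rw [update_of_ne (by simp)]
    refine set_config_array G ρ s rest R a (ρ x) _ _ fun w => ?_
    by_cases h : w = ρ x <;> simp [h]

/-- The loop counter is the variable itself. A delimiter and `n` units are pushed above the old
value; each iteration pops one unit, and what remains represents the current vertex. Popping the
delimiter ends the loop and uncovers the old value. The arbitrary `rest` in the definition of
`Action.IsPoly` makes this nesting possible. -/
theorem Action.IsPoly.forEach {f : Action ι κ} (hf : f.IsPoly α) (x : ι) :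
    (Action.forEach x f).IsPoly α := by
  obtain ⟨c, p, hc⟩ := hf
  refine ⟨.seq (.push (some (.var x)) false) <| .seq (copyTo .size (.var x)) <|
    whileTop (.var x) c, .X * (p + 6) + 5, fun n G ρ s rest R => ?_⟩
  classical
  set old := List.replicate (n - 1 - (ρ x : ℕ)) true ++ false :: rest x with hold
  -- Here `j` is the number of remaining iterations: the vertices still to be treated are the last
  -- `j` ones.
  have key : ∀ j ≤ n, ∀ s : κ → Finset (Fin n), Run (whileTop (.var x) c)
      (update (config G ρ s rest R) (.var x) (List.replicate j true ++ false :: old))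
      (config G ρ (((List.finRange n).drop (n - j)).foldl (fun s i => f n G (update ρ x i) s) s)
        rest R) (j * (p.eval n + 1) + 1) := by
    intro j
    induction j with
    | zero =>
      intro _ s
      refine ((Run.whileTop_false (l := old) (by simp)).mono (by simp)).congr rfl ?_
      simp only [update_idem, tsub_zero]
      rw [List.drop_of_length_le (by simp)]
      rw [hold, update_config_var]
      simp
    | succ j ih =>
      intro hj s
      have hlt : n - (j + 1) < (List.finRange n).length := by simp; omega
      rw [List.drop_eq_getElem_cons hlt, List.foldl_cons,
        show n - (j + 1) + 1 = n - j by omega]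
      refine (Run.whileTop_true (l := List.replicate j true ++ false :: old)
        (by simp [List.replicate_succ]) ?_ (ih (by omega) _)).mono (T := 1 +
          (p.eval n + (j * (p.eval n + 1) + 1))) (by grind)
      -- After one of `j + 1` units has been popped, the `j` units left represent the vertex `n - (j
      -- + 1)`, so the vertices come in increasing order.
      have hi : n - 1 - ((⟨n - (j + 1), by omega⟩ : Fin n) : ℕ) = j := by
        simp
        omega
      have h₁ := update_config_var G ρ s rest R x ⟨n - (j + 1), by omega⟩ old
      have h₂ := update_config_var G ρ (f n G (update ρ x ⟨n - (j + 1), by omega⟩) s) rest R x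
        ⟨n - (j + 1), by omega⟩ old
      rw [hi] at h₁ h₂
      refine (hc n G (update ρ x ⟨n - (j + 1), by omega⟩) s (update rest x old) R).congr ?_ ?_
      · rw [update_idem, h₁]
      · simp [h₂]
  have h := key n le_rfl s
  refine ((Run.push (.var x) false).seq ((Run.copy (i := n) (l := []) (by simp) (by simp)
    (by simp) ?_ ?_).seq (h.congr ?_ ?_))).mono ?_
  · simp [config]
  · simp [config]
  · simp [config, hold]
  · simp [Action.forEach]
  · simp
    grind

end

end StackProgram

/-! ### Boundaries and the fan version of Menger's theorem -/

namespace VectorConnectivity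

open Finset

variable {V : Type*} [Fintype V] [DecidableEq V]

open Classical in
/-- The vertices outside `X` with a neighbour in `X`. -/
noncomputable def boundary (G : SimpleGraph V) (X : Finset V) : Finset V :=
  {w | w ∉ X ∧ ∃ u ∈ X, G.Adj u w}

@[simp]
theorem mem_boundary {G : SimpleGraph V} {X : Finset V} {w : V} :
    w ∈ boundary G X ↔ w ∉ X ∧ ∃ u ∈ X, G.Adj u w := by
  simp [boundary]

/-- Disjoint paths from `v ∈ X` to vertices outside `X` leave `X` through distinct vertices. -/
theorem le_card_boundary {G : SimpleGraph V} {v : V} {S X : Finset V} {r : ℕ}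
    (h : HasDisjointPaths G v S r) (hv : v ∈ X) (hX : Disjoint X S) :
    r ≤ #(boundary G X) := by
  obtain ⟨t, p, ht, hp⟩ := h
  have key : ∀ i, ∃ w, w ∈ (p i : G.Walk v (t i)).support ∧ w ∈ boundary G X := by
    intro i
    obtain ⟨e, he, h₁, h₂⟩ := (p i : G.Walk v (t i)).exists_boundary_dart (↑X) hv
      (fun h => Finset.disjoint_left.1 hX h (ht i))
    exact ⟨e.snd, SimpleGraph.Walk.dart_snd_mem_support_of_mem_darts _ he,
      mem_boundary.2 ⟨h₂, e.fst, h₁, e.adj⟩⟩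
  choose w hw hwX using key
  have hinj : Function.Injective w := by
    intro i j hij
    by_contra hne
    have := hp i j hne (w i) (hw i) (hij ▸ hw j)
    exact (mem_boundary.1 (hwX i)).1 (this ▸ hv)
  calc r = #(univ : Finset (Fin r)) := by simp
    _ ≤ _ := Finset.card_le_card_of_injOn w (fun i _ => hwX i) hinj.injOn

section Fan

variable (G : SimpleGraph V) (v : V) (S : Finset V) {r : ℕ}

/-- The vertices that are reached from the start vertex `g (inr i)` by following `g`. -/
inductive Orbit (g : {u // u ∉ insert v S} ⊕ Fin r → V) (i : Fin r) : V → Prop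
  | start : Orbit g i (g (.inr i))
  | step (u : {u // u ∉ insert v S}) : Orbit g i u → Orbit g i (g (.inl u))

variable {G v S}

-- By injectivity every orbit can be traced backwards in only one way, and a start vertex has no
-- predecessor inside the orbit, so both traces end at the same start.
omit [Fintype V] in
theorem Orbit.eq_of_injective {g : {u // u ∉ insert v S} ⊕ Fin r → V} (hg : Function.Injective g)
    {i j : Fin r} {x : V} (hi : Orbit v S g i x) (hj : Orbit v S g j x) : i = j := by
  induction hi with
  | start =>
    generalize hx : g (.inr i) = x at hj
    cases hj with
    | start => exact Sum.inr_injective (hg hx)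
    | step u _ => cases hg hx
  | step u _ ih =>
    generalize hx : g (.inl u) = x at hj
    cases hj with
    | start => cases hg hx
    | step u' hu' =>
      cases hg hx
      exact ih hu'

/-- An orbit that never meets `S` stays inside the domain of `g`, since it also avoids `v`. Then `g`
maps the finite orbit injectively into itself without its start vertex, which is impossible by
counting. -/
theorem Orbit.exists_mem {g : {u // u ∉ insert v S} ⊕ Fin r → V} (hg : Function.Injective g)
    (hv : ∀ a, g a ≠ v) (i : Fin r) : ∃ x ∈ S, Orbit v S g i x := by
  classical
  by_contra! h
  have hout : ∀ x, Orbit v S g i x → x ∉ insert v S := by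
    intro x hx hxS
    rcases Finset.mem_insert.1 hxS with hxv | hxS
    · cases hx <;> exact hv _ hxv
    · exact h x hxS hx
  let O : Finset V := {x | Orbit v S g i x}
  have hO : ∀ x, x ∈ O ↔ Orbit v S g i x := by simp [O]
  have hcard : #O ≤ #(O.erase (g (.inr i))) := by
    refine Finset.card_le_card_of_injOn
      (fun x => if hx : x ∉ insert v S then g (.inl ⟨x, hx⟩) else x) ?_ ?_
    · intro x hx
      have hx := (hO x).1 hx
      have hx' := hout x hx
      simp only [dif_pos hx', Finset.coe_erase, Set.mem_sdiff, Set.mem_singleton_iff]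
      refine ⟨(hO _).2 (.step ⟨x, hx'⟩ hx), fun he => ?_⟩
      cases hg he
    · intro x hx y hy hxy
      have hx' := hout x ((hO x).1 hx)
      have hy' := hout y ((hO y).1 hy)
      simp only [dif_pos hx', dif_pos hy'] at hxy
      simpa using hg hxy
  have := Finset.card_erase_lt_of_mem ((hO _).2 (Orbit.start (g := g) (v := v) (S := S) (i := i)))
  omega

/-- If no set that contains `v` and avoids `S` has a small boundary, then there are many disjoint
paths from `v` to `S`: the fan version of Menger's theorem, by way of Hall's theorem. -/
theorem hasDisjointPaths_of_le_card_boundary (hvS : v ∉ S)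
    (h : ∀ X : Finset V, v ∈ X → Disjoint X S → r ≤ #(boundary G X)) :
    HasDisjointPaths G v S r := by
  classical
  -- Hall's theorem is applied to the vertices outside `insert v S` together with `r` copies of `v`.
  -- Each is to choose a successor; a vertex may choose itself, which lets it stay unused by the
  -- paths.
  let N : V → Finset V := fun u => ({w | w = u ∨ G.Adj u w} : Finset V).erase v
  let t : {u // u ∉ insert v S} ⊕ Fin r → Finset V := Sum.elim (fun u => N u) (fun _ => N v)
  have hall : ∀ s : Finset ({u // u ∉ insert v S} ⊕ Fin r), #s ≤ #(s.biUnion t) := by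
    intro s
    let U : Finset V := s.toLeft.map (Function.Embedding.subtype _)
    have hU : ∀ u, u ∈ U ↔ ∃ hu : u ∉ insert v S, Sum.inl ⟨u, hu⟩ ∈ s := by simp [U]
    have hUs : U ⊆ s.biUnion t := by
      intro u hu
      obtain ⟨hu', hus⟩ := (hU u).1 hu
      refine Finset.mem_biUnion.2 ⟨_, hus, ?_⟩
      have : u ≠ v := fun h => hu' (h ▸ Finset.mem_insert_self _ _)
      simp [t, N, this]
    have hcard : #s = #U + #s.toRight := by
      rw [Finset.card_map, Finset.card_toLeft_add_card_toRight]
    rcases s.toRight.eq_empty_or_nonempty with hs | ⟨i, hi⟩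
    · rw [hcard, hs, Finset.card_empty, add_zero]
      exact Finset.card_le_card hUs
    · have hvU : v ∉ U := fun hv => ((hU v).1 hv).1 (Finset.mem_insert_self _ _)
      -- If a copy of `v` is present, the available successors include `U` and the boundary of
      -- `insert v U`. The boundary has at least `r` vertices, enough for all copies of `v`.
      have hb := h (insert v U) (Finset.mem_insert_self _ _) (by
        rw [Finset.disjoint_insert_left]
        refine ⟨hvS, Finset.disjoint_left.2 fun u hu huS => ?_⟩
        exact ((hU u).1 hu).1 (Finset.mem_insert_of_mem huS))
      have hr : #s.toRight ≤ r := (Finset.card_le_univ _).trans (by simp)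
      have hsub : U ∪ boundary G (insert v U) ⊆ s.biUnion t := by
        refine Finset.union_subset hUs fun w hw => ?_
        obtain ⟨hw, u, hu, huw⟩ := mem_boundary.1 hw
        have hwv : w ≠ v := fun h => hw (h ▸ Finset.mem_insert_self _ _)
        rcases Finset.mem_insert.1 hu with rfl | hu
        · exact Finset.mem_biUnion.2 ⟨_, Finset.mem_toRight.1 hi, by simp [t, N, hwv, huw]⟩
        · obtain ⟨hu', hus⟩ := (hU u).1 hu
          exact Finset.mem_biUnion.2 ⟨_, hus, by simp [t, N, hwv, huw]⟩
      have hdisj : Disjoint U (boundary G (insert v U)) :=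
        Finset.disjoint_left.2 fun u hu hu' =>
          (mem_boundary.1 hu').1 (Finset.mem_insert_of_mem hu)
      calc #s ≤ #U + #(boundary G (insert v U)) := by omega
        _ = #(U ∪ boundary G (insert v U)) := (Finset.card_union_of_disjoint hdisj).symm
        _ ≤ _ := Finset.card_le_card hsub
  obtain ⟨g, hg, hgt⟩ := (Finset.all_card_le_biUnion_card_iff_exists_injective t).1 hall
  have hgv : ∀ a, g a ≠ v := by
    intro a
    have := hgt a
    rcases a with a | a <;> simp [t, N] at this <;> exact this.1
  have walk : ∀ i x, Orbit v S g i x →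
      ∃ p : G.Walk v x, ∀ y ∈ p.support, y = v ∨ Orbit v S g i y := by
    intro i x hx
    induction hx with
    | start =>
      have := hgt (.inr i)
      simp only [t, N, Sum.elim_inr, Finset.mem_erase, Finset.mem_filter, Finset.mem_univ,
        true_and] at this
      have hadj := this.2.resolve_left this.1
      refine ⟨hadj.toWalk, fun y hy => ?_⟩
      rcases (by simpa using hy : y = v ∨ y = g (.inr i)) with hy | rfl
      · exact .inl hy
      · exact .inr .start
    | step u hu ih =>
      obtain ⟨p, hp⟩ := ih
      have := hgt (.inl u)
      simp only [t, N, Sum.elim_inl, Finset.mem_erase, Finset.mem_filter, Finset.mem_univ,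
        true_and] at this
      -- A vertex that is its own successor leaves the walk unchanged.
      rcases this.2 with he | hadj
      · rw [he]
        exact ⟨p, hp⟩
      · refine ⟨p.concat hadj, fun y hy => ?_⟩
        rw [SimpleGraph.Walk.support_concat, List.mem_append] at hy
        rcases hy with hy | hy
        · exact hp y hy
        · rw [List.mem_singleton.1 hy]
          exact .inr (.step u hu)
  choose x hxS hx using Orbit.exists_mem hg hgv
  choose p hp using fun i => walk i (x i) (hx i)
  refine ⟨x, fun i => (p i).toPath, hxS, fun i j hij y hi hj => ?_⟩
  have hi := hp i y (SimpleGraph.Walk.support_toPath_subset_support _ hi)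
  have hj := hp j y (SimpleGraph.Walk.support_toPath_subset_support _ hj)
  rcases hi with hi | hi
  · exact hi
  · rcases hj with hj | hj
    · exact hj
    · exact absurd (hi.eq_of_injective hg hj) hij

end Fan

/-! ### Small cuts, minimal parts and the packing bound -/

section Packing

variable (G : SimpleGraph V) (φ : V → ℕ)

/-- The set `T` can be left only through `Z`. -/
def Closed (Z T : Finset V) : Prop := ∀ u ∈ T, ∀ w, G.Adj u w → w ∉ Z → w ∈ T

open Classical in
/-- The smallest set that contains `v` and that can be left only through `Z`. -/
noncomputable def reach (Z : Finset V) (v : V) : Finset V :=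
  {w | ∀ T, v ∈ T → Closed G Z T → w ∈ T}

/-- A small set `Z` that separates `v` from `S`. -/
structure IsCut (S : Finset V) (v : V) (Z : Finset V) : Prop where
  notMem : v ∉ Z
  card_lt : #Z < φ v
  disjoint : Disjoint (reach G Z v) S

/-- `P` is empty if there is no cut, and otherwise consists of a vertex `v` and a set `Z` that form
a cut with an inclusion-minimal part `X` cut off. -/
def IsMinimalCut (S X P : Finset V) : Prop :=
  (P = ∅ ∧ ∀ v Z, ¬ IsCut G φ S v Z) ∨
  ∃ v Z, IsCut G φ S v Z ∧ X = reach G Z v ∧ P = insert v Z ∧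
    ∀ v' Z', IsCut G φ S v' Z' → reach G Z' v' ⊆ X → X ⊆ reach G Z' v'

/-- The set `S` is paid for by a family of disjoint sets each of which meets every vector
connectivity set, and which later cuts do not touch. -/
def Packed (d : ℕ) (S : Finset V) : Prop :=
  ∃ 𝒳 : Finset (Finset V), (𝒳 : Set (Finset V)).PairwiseDisjoint id ∧
    (∀ X ∈ 𝒳, ∃ v ∈ X, #(boundary G X) < φ v) ∧ #S ≤ d * #𝒳 ∧
    ∀ X ∈ 𝒳, ∀ v Z, IsCut G φ S v Z → Disjoint (reach G Z v) X

variable {G φ} {S X P Z T : Finset V} {v : V} {d : ℕ}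

theorem mem_reach_self : v ∈ reach G Z v := by
  simp only [reach, mem_filter_univ]
  exact fun T hT _ => hT

theorem reach_subset (hv : v ∈ T) (hT : Closed G Z T) : reach G Z v ⊆ T := by
  intro w hw
  simp only [reach, mem_filter_univ] at hw
  exact hw T hv hT

theorem closed_reach : Closed G Z (reach G Z v) := by
  intro u hu w huw hw
  simp only [reach, mem_filter_univ] at hu ⊢
  exact fun T hv hT => hT u (hu T hv hT) w huw hw

theorem eq_reach (hv : v ∈ X) (hX : Closed G Z X) (h : ∀ T, v ∈ T → Closed G Z T → X ⊆ T) :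
    X = reach G Z v :=
  (h _ mem_reach_self closed_reach).antisymm (reach_subset hv hX)

theorem boundary_reach_subset : boundary G (reach G Z v) ⊆ Z := by
  intro w hw
  obtain ⟨hw, u, hu, huw⟩ := mem_boundary.1 hw
  by_contra hwZ
  exact hw (closed_reach u hu w huw hwZ)

theorem IsCut.mono {S' : Finset V} (h : IsCut G φ S' v Z) (hS : S ⊆ S') : IsCut G φ S v Z :=
  ⟨h.notMem, h.card_lt, h.disjoint.mono_right hS⟩

theorem packed_empty : Packed G φ d ∅ := ⟨∅, by simp, by simp, by simp, by simp⟩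

/-- The part of the new cut joins the family: it is disjoint from the older parts by the last clause
of `Packed`, and it pays for `#Z + 1 ≤ φ v ≤ d` vertices. The last clause survives because a part of
a later cut avoids `v` and `Z`, so it lies inside the new part or misses it, and minimality excludes
the former. -/
theorem Packed.union (hφ : ∀ v, φ v ≤ d) (hS : Packed G φ d S) (hP : IsMinimalCut G φ S X P) :
    Packed G φ d (S ∪ P) := by
  rcases hP with ⟨rfl, _⟩ | ⟨v, Z, hc, rfl, rfl, hmin⟩
  · rwa [Finset.union_empty]
  obtain ⟨𝒳, hdisj, hb, hcard, hlater⟩ := hS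
  have hnew : ∀ Y ∈ 𝒳, Disjoint (reach G Z v) Y := fun Y hY => hlater Y hY v Z hc
  have hnotMem : reach G Z v ∉ 𝒳 := fun h =>
    Finset.disjoint_left.1 (hnew _ h) mem_reach_self mem_reach_self
  refine ⟨insert (reach G Z v) 𝒳, ?_, ?_, ?_, ?_⟩
  · rw [Finset.coe_insert]
    exact hdisj.insert fun Y hY _ => hnew Y hY
  · intro Y hY
    rcases Finset.mem_insert.1 hY with rfl | hY
    · exact ⟨v, mem_reach_self, (Finset.card_le_card boundary_reach_subset).trans_lt hc.card_lt⟩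
    · exact hb Y hY
  · have h₁ := Finset.card_union_le S (insert v Z)
    have h₂ := Finset.card_insert_le v Z
    have h₃ := hc.card_lt
    have h₄ := hφ v
    rw [Finset.card_insert_of_notMem hnotMem, Nat.mul_succ]
    omega
  · intro Y hY v' Z' hc'
    have hold := hc'.mono (Finset.subset_union_left (s₂ := insert v Z))
    rcases Finset.mem_insert.1 hY with rfl | hY
    · have havoid : ∀ u ∈ reach G Z' v', u ∉ insert v Z := fun u hu hu' =>
        Finset.disjoint_left.1 hc'.disjoint hu (Finset.mem_union_right _ hu')
      by_cases hv' : v' ∈ reach G Z v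
      -- Edges out of `reach G Z v` end in `Z`, which the later part avoids. The intersection is
      -- therefore closed and contains the whole later part.
      · have hsub : reach G Z' v' ⊆ reach G Z' v' ∩ reach G Z v := by
          refine reach_subset (Finset.mem_inter.2 ⟨mem_reach_self, hv'⟩) fun u hu w huw hw => ?_
          obtain ⟨hu, hu'⟩ := Finset.mem_inter.1 hu
          have hw' := closed_reach u hu w huw hw
          exact Finset.mem_inter.2 ⟨hw', closed_reach u hu' w huw fun h =>
            havoid w hw' (Finset.mem_insert_of_mem h)⟩
        have := hmin v' Z' hold (hsub.trans Finset.inter_subset_right)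
        exact absurd (Finset.mem_insert_self v Z) (havoid v (this mem_reach_self))
      -- An edge from the later part into `reach G Z v`, read backwards, would leave `reach G Z v`
      -- at a vertex outside `Z`.
      · have hsub : reach G Z' v' ⊆ reach G Z' v' \ reach G Z v := by
          refine reach_subset (Finset.mem_sdiff.2 ⟨mem_reach_self, hv'⟩) fun u hu w huw hw => ?_
          obtain ⟨hu, hu'⟩ := Finset.mem_sdiff.1 hu
          refine Finset.mem_sdiff.2 ⟨closed_reach u hu w huw hw, fun h => hu' ?_⟩
          exact closed_reach w h u huw.symm fun h => havoid u hu (Finset.mem_insert_of_mem h)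
        exact Finset.disjoint_left.2 fun u hu => (Finset.mem_sdiff.1 (hsub hu)).2
    · exact hlater Y hY v' Z' hold

/-- If there is no cut for `S`, then `S` is a vector connectivity set. -/
theorem hasDisjointPaths_of_forall_not_isCut (h : ∀ v Z, ¬ IsCut G φ S v Z) (hv : v ∉ S) :
    HasDisjointPaths G v S (φ v) := by
  refine hasDisjointPaths_of_le_card_boundary hv fun Y hvY hY => ?_
  by_contra! hlt
  -- A set `Y` that violates Menger's condition can be left only through its boundary, so this
  -- boundary is a cut.
  refine h v (boundary G Y)
    ⟨fun h => (mem_boundary.1 h).1 hvY, hlt, hY.mono_left (reach_subset hvY ?_)⟩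
  intro u hu w huw hw
  by_contra hwY
  exact hw (mem_boundary.2 ⟨hwY, u, hu, huw⟩)

/-- Adding minimal cuts repeatedly leads to a set for which there is no cut. -/
theorem not_isCut_of_minimalCuts {A P X : ℕ → Finset V}
    (hA : ∀ k, A (k + 1) = A k ∪ P k) (hP : ∀ k, IsMinimalCut G φ (A k) (X k) (P k)) (Z : Finset V) :
    ¬ IsCut G φ (A (Fintype.card V)) v Z := by
  -- While cuts exist, each round adds a source that was not yet in the set, so the set grows. Once
  -- it contains all vertices no cut is left, because a part contains its source.
  have key : ∀ k, (∀ v Z, ¬ IsCut G φ (A k) v Z) ∨ k ≤ #(A k) := by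
    intro k
    induction k with
    | zero => exact .inr (Nat.zero_le _)
    | succ k ih =>
      rw [hA]
      rcases ih with ih | ih
      · exact .inl fun v Z h => ih v Z (h.mono Finset.subset_union_left)
      · rcases hP k with ⟨_, h⟩ | ⟨v, Z, hc, _, hZ, _⟩
        · exact .inl fun v Z h' => h v Z (h'.mono Finset.subset_union_left)
        · have hv : v ∉ A k := Finset.disjoint_left.1 hc.disjoint mem_reach_self
          refine .inr (ih.trans_lt (Finset.card_lt_card ?_))
          refine Finset.ssubset_iff.2 ⟨v, hv, Finset.insert_subset ?_ Finset.subset_union_left⟩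
          rw [hZ]
          exact Finset.mem_union_right _ (Finset.mem_insert_self _ _)
  intro hc
  rcases key (Fintype.card V) with h | h
  · exact h v Z hc
  · rw [Finset.eq_univ_of_card _ ((Finset.card_le_univ _).antisymm h)] at hc
    exact Finset.disjoint_left.1 hc.disjoint mem_reach_self (Finset.mem_univ _)

/-- A packed set is at most `d` times as large as any vector connectivity set. -/
theorem Packed.card_le (hS : Packed G φ d S) {S' : Finset V}
    (hS' : ∀ v ∉ S', HasDisjointPaths G v S' (φ v)) : #S ≤ d * #S' := by
  obtain ⟨𝒳, hdisj, hb, hcard, -⟩ := hS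
  refine hcard.trans (Nat.mul_le_mul_left d ?_)
  have hit : ∀ X ∈ 𝒳, ∃ v ∈ X, v ∈ S' := by
    intro X hX
    by_contra! h
    obtain ⟨v, hv, hlt⟩ := hb X hX
    exact absurd (le_card_boundary (hS' v (h v hv)) hv (Finset.disjoint_left.2 h)) (by omega)
  rcases 𝒳.eq_empty_or_nonempty with rfl | ⟨X₀, hX₀⟩
  · simp
  -- Needed only as a default value for the choice function outside the family.
  have : Nonempty V := ⟨(hb X₀ hX₀).choose⟩
  choose! f hf hfS using hit
  refine Finset.card_le_card_of_injOn f hfS fun X hX Y hY hXY => ?_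
  by_contra hne
  exact Finset.disjoint_left.1 (hdisj hX hY hne) (hf X hX) (hXY ▸ hf Y hY)

end Packing

end VectorConnectivity

/-! ### The approximation algorithm as an action, and what its pieces compute -/

namespace VectorConnectivity

open Function StackProgram

/-- The loop variables of the approximation algorithm. -/
inductive LoopVar (d : ℕ) : Type
  | round
  | source
  | sep (i : Fin d)
  | iter
  | tail
  | head
  deriving DecidableEq, Fintype

/-- The vertex sets that the approximation algorithm works with. -/
inductive SetVar (d : ℕ) : Type
  | solution
  | part
  | payment
  | reached
  | cut
  | flag
  | demand (i : Fin (d + 1))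
  deriving DecidableEq, Fintype

section Fold

variable {V : Type*} {β : Type*}

/-- Reduces a loop that modifies a single set to a fold over the values of that set. -/
theorem foldl_update {κ γ : Type*} [DecidableEq κ] {f : (κ → γ) → β → κ → γ} {s : κ → γ} {b : κ}
    {g : γ → β → γ} (hf : ∀ i t, f (update s b t) i = update s b (g t i)) (l : List β) (t : γ) :
    l.foldl f (update s b t) = update s b (l.foldl g t) := by
  induction l generalizing t with
  | nil => rfl
  | cons i l ih => rw [List.foldl_cons, hf, ih, List.foldl_cons]

theorem subset_foldl {f : Finset V → β → Finset V} (hf : ∀ t i, t ⊆ f t i) (l : List β)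
    (t : Finset V) : t ⊆ l.foldl f t := by
  induction l generalizing t with
  | nil => rfl
  | cons i l ih => exact (hf t i).trans (ih _)

theorem foldl_subset {f : Finset V → β → Finset V} {T : Finset V}
    (hf : ∀ t i, t ⊆ T → f t i ⊆ T) (l : List β) {t : Finset V} (ht : t ⊆ T) :
    l.foldl f t ⊆ T := by
  induction l generalizing t with
  | nil => exact ht
  | cons i l ih => exact ih (hf t i ht)

/-- Steps that only enlarge the set cannot undo each other, so a fold that returns to its start was
stationary throughout. In this way a pass without effect shows that no single edge enlarges the
reached set. -/
theorem eq_of_foldl_eq {f : Finset V → β → Finset V} (hf : ∀ t i, t ⊆ f t i) {l : List β}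
    {t : Finset V} (h : l.foldl f t = t) {i : β} (hi : i ∈ l) : f t i = t := by
  induction l with
  | nil => simp at hi
  | cons j l ih =>
    rw [List.foldl_cons] at h
    have hj : f t j = t := by
      refine Finset.Subset.antisymm ?_ (hf t j)
      conv_rhs => rw [← h]
      exact subset_foldl hf l _
    rcases List.mem_cons.1 hi with rfl | hi
    · exact hj
    · exact ih (by rwa [hj] at h) hi

/-- The set grows strictly until it is fixed, so without a fixed point it would have more than
`Fintype.card V` elements. Monotonicity of `f` plays no role. -/
theorem iterate_card_fixed [Fintype V] {f : Finset V → Finset V} (hf : ∀ t, t ⊆ f t)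
    (t : Finset V) : f (f^[Fintype.card V] t) = f^[Fintype.card V] t := by
  have key : ∀ k, f (f^[k] t) = f^[k] t ∨ k + 1 ≤ (f (f^[k] t)).card := by
    intro k
    induction k with
    | zero =>
      by_cases h : f t = t
      · exact .inl h
      · exact .inr (Nat.succ_le_of_lt ((Nat.zero_le _).trans_lt
          (Finset.card_lt_card ((hf t).ssubset_of_ne (Ne.symm h)))))
    | succ k ih =>
      rw [iterate_succ_apply']
      by_cases h : f (f (f^[k] t)) = f (f^[k] t)
      · exact .inl h
      · rcases ih with ih | ih
        · exact absurd (congrArg f ih) h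
        · exact .inr (Nat.succ_le_of_lt (ih.trans_lt
            (Finset.card_lt_card ((hf _).ssubset_of_ne (Ne.symm h)))))
  rcases key (Fintype.card V) with h | h
  · exact h
  · exact absurd (h.trans (Finset.card_le_univ _)) (by omega)

end Fold

noncomputable section

variable {d : ℕ}

namespace Program

open Action Test LoopVar SetVar

/-- Make the set `a` empty. -/
def clear (a : SetVar d) : Action (LoopVar d) (SetVar d) := forEach head (erase a head)

/-- Make the set `a` contain all vertices. -/
def fill (a : SetVar d) : Action (LoopVar d) (SetVar d) := forEach head (Action.insert a head)

/-- Replace the set `b` by the set `a`. -/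
def assign (a b : SetVar d) : Action (LoopVar d) (SetVar d) :=
  forEach head (seq (erase b head) (when (mem a head) (Action.insert b head)))

/-- Add the set `a` to the set `b`. -/
def addTo (a b : SetVar d) : Action (LoopVar d) (SetVar d) :=
  forEach head (when (mem a head) (Action.insert b head))

/-- Insert the vertices `sep i` into the cut, as many as the demand of the source allows. -/
def insertSeps (l : List (Fin d)) : Action (LoopVar d) (SetVar d) :=
  l.foldr (fun i f => seq (when (mem (demand i.succ) source) (Action.insert cut (sep i))) f) skip

/-- Compute the cut. -/
def buildCut : Action (LoopVar d) (SetVar d) :=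
  seq (clear cut) (seq (insertSeps (List.finRange d)) (erase cut source))

/-- Enlarge the reached set along every edge. -/
def pass : Action (LoopVar d) (SetVar d) :=
  forEach tail (forEach head (when (and (mem reached tail) (and (adj tail head)
    (not (mem cut head)))) (Action.insert reached head)))

/-- Compute the part that contains the source and is cut off. -/
def buildReached : Action (LoopVar d) (SetVar d) :=
  seq (clear reached) (seq (Action.insert reached source) (forEach iter pass))

/-- Let the flag contain the source if and only if there is a cut that improves on the part. -/
def setFlag : Action (LoopVar d) (SetVar d) :=
  seq (clear flag) (seq (when (mem (demand 0) source) (Action.insert flag source))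
    (forEach head (when (and (mem reached head) (not (and (not (mem solution head))
      (mem part head)))) (erase flag source))))

/-- Replace the part and the payment. -/
def improve : Action (LoopVar d) (SetVar d) :=
  seq (assign reached part) (seq (assign cut payment) (Action.insert payment source))

/-- Try one pair of a source and a cut. -/
def attempt : Action (LoopVar d) (SetVar d) :=
  seq buildCut (seq buildReached (seq setFlag (when (mem flag source) improve)))

/-- Try all values of some of the vertices of the cut. -/
def allSeps (l : List (Fin d)) : Action (LoopVar d) (SetVar d) :=
  l.foldr (fun i f => forEach (sep i) f) attempt

/-- Find a minimal cut and add it to the solution. -/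
def oneRound : Action (LoopVar d) (SetVar d) :=
  seq (seq (fill part) (clear payment)) (seq (forEach source (allSeps (List.finRange d)))
    (addTo payment solution))

/-- The approximation algorithm. -/
def approximate : Action (LoopVar d) (SetVar d) := forEach round oneRound

theorem isPoly_approximate (α : Type) : (approximate (d := d)).IsPoly α := by
  have hclear (a) : (clear (d := d) a).IsPoly α := .forEach (.erase a head) head
  have hassign (a b) : (assign (d := d) a b).IsPoly α :=
    .forEach (.seq (.erase b head) (.when (.mem a head) (.insert b head))) head
  have hseps (l) : (insertSeps (d := d) l).IsPoly α := by
    induction l with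
    | nil => exact .skip
    | cons i l ih =>
      exact Action.IsPoly.seq (f := when (mem (demand i.succ) source) (Action.insert cut (sep i)))
        (g := insertSeps l) (.when (.mem _ _) (.insert _ _)) ih
  have hcut : (buildCut (d := d)).IsPoly α := .seq (hclear _) (.seq (hseps _) (.erase _ _))
  have hpass : (pass (d := d)).IsPoly α :=
    .forEach (.forEach (.when (.and (.mem _ _) (.and (.adj _ _) (.not (.mem _ _))))
      (.insert _ _)) _) _
  have hreached : (buildReached (d := d)).IsPoly α :=
    .seq (hclear _) (.seq (.insert _ _) (.forEach hpass _))
  have hflag : (setFlag (d := d)).IsPoly α :=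
    .seq (hclear _) (.seq (.when (.mem _ _) (.insert _ _)) (.forEach (.when (.and (.mem _ _)
      (.not (.and (.not (.mem _ _)) (.mem _ _)))) (.erase _ _)) _))
  have himprove : (improve (d := d)).IsPoly α :=
    .seq (hassign _ _) (.seq (hassign _ _) (.insert _ _))
  have hattempt : (attempt (d := d)).IsPoly α :=
    .seq hcut (.seq hreached (.seq hflag (.when (.mem _ _) himprove)))
  have hall (l) : (allSeps (d := d) l).IsPoly α := by
    induction l with
    | nil => exact hattempt
    | cons i l ih => exact Action.IsPoly.forEach (f := allSeps l) ih _
  exact .forEach (.seq (.seq (.forEach (.insert _ _) _) (hclear _))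
    (.seq (.forEach (hall _) _) (.forEach (.when (.mem _ _) (.insert _ _)) _))) _

section Semantics

variable {n : ℕ} (G : SimpleGraph (Fin n)) (ρ : LoopVar d → Fin n)
  (s : SetVar d → Finset (Fin n))

theorem clear_apply (a : SetVar d) : clear a n G ρ s = update s a ∅ := by
  have h := foldl_update (f := fun s i => Action.erase a head n G (update ρ head i) s)
    (s := s) (b := a) (g := fun t i => t.erase i) (fun i t => by simp [Action.erase])
    (List.finRange n) (s a)
  rw [update_eq_self] at h
  rw [clear, forEach, h]
  congr 1
  have key : ∀ (l : List (Fin n)) (t : Finset (Fin n)), l.foldl (fun t i => t.erase i) t =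
      t \ l.toFinset := by
    intro l
    induction l with
    | nil => simp
    | cons i l ih =>
      intro t
      rw [List.foldl_cons, ih]
      ext
      simp
      tauto
  rw [key]
  ext
  simp

theorem fill_apply (a : SetVar d) : fill a n G ρ s = update s a Finset.univ := by
  have h := foldl_update (f := fun s i => Action.insert a head n G (update ρ head i) s)
    (s := s) (b := a) (g := fun t i => Insert.insert i t) (fun i t => by simp [Action.insert])
    (List.finRange n) (s a)
  rw [update_eq_self] at h
  rw [fill, forEach, h]
  congr 1
  have key : ∀ (l : List (Fin n)) (t : Finset (Fin n)),
      l.foldl (fun t i => Insert.insert i t) t = t ∪ l.toFinset := by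
    intro l
    induction l with
    | nil => simp
    | cons i l ih =>
      intro t
      rw [List.foldl_cons, ih]
      ext
      simp
  rw [key]
  ext
  simp

theorem assign_apply {a b : SetVar d} (hab : a ≠ b) : assign a b n G ρ s = update s b (s a) := by
  have h := foldl_update (f := fun s i => seq (erase b head) (when (mem a head)
      (Action.insert b head)) n G (update ρ head i) s)
    (s := s) (b := b) (g := fun t i => if i ∈ s a then Insert.insert i (t.erase i) else t.erase i)
    (fun i t => by
      by_cases hi : i ∈ s a <;> simp [Action.insert, Action.erase, seq, when, mem, hab, hi])
    (List.finRange n) (s b)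
  rw [update_eq_self] at h
  rw [assign, forEach, h]
  congr 1
  have key : ∀ (l : List (Fin n)) (t : Finset (Fin n)) (w : Fin n),
      w ∈ l.foldl (fun t i => if i ∈ s a then Insert.insert i (t.erase i) else t.erase i) t ↔
        if w ∈ l then w ∈ s a else w ∈ t := by
    intro l
    induction l with
    | nil => simp
    | cons i l ih =>
      intro t w
      rw [List.foldl_cons, ih]
      by_cases hw : w ∈ l
      · simp [hw]
      · rcases eq_or_ne w i with rfl | hwi
        · by_cases hi : w ∈ s a <;> simp [hw, hi]
        · by_cases hi : i ∈ s a <;> simp [hw, hi, hwi]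
  ext w
  rw [key]
  simp

theorem addTo_apply {a b : SetVar d} (hab : a ≠ b) :
    addTo a b n G ρ s = update s b (s b ∪ s a) := by
  have h := foldl_update (f := fun s i => when (mem a head)
      (Action.insert b head) n G (update ρ head i) s)
    (s := s) (b := b) (g := fun t i => if i ∈ s a then Insert.insert i t else t)
    (fun i t => by
      by_cases hi : i ∈ s a <;> simp [Action.insert, when, mem, hab, hi])
    (List.finRange n) (s b)
  rw [update_eq_self] at h
  rw [addTo, forEach, h]
  congr 1
  have key : ∀ (l : List (Fin n)) (t : Finset (Fin n)) (w : Fin n),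
      w ∈ l.foldl (fun t i => if i ∈ s a then Insert.insert i t else t) t ↔
        w ∈ t ∨ w ∈ l ∧ w ∈ s a := by
    intro l
    induction l with
    | nil => simp
    | cons i l ih =>
      intro t w
      rw [List.foldl_cons, ih]
      by_cases hi : i ∈ s a
      · simp [hi]
        grind
      · simp [hi]
        grind
  ext w
  rw [key]
  simp

theorem insertSeps_apply (l : List (Fin d)) (t : Finset (Fin n)) :
    insertSeps l n G ρ (update s cut t) = update s cut
      (t ∪ ({i | i ∈ l ∧ ρ source ∈ s (demand i.succ)} : Finset (Fin d)).image (ρ ∘ sep)) := by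
  induction l generalizing t with
  | nil => simp [insertSeps, skip]
  | cons i l ih =>
    rw [insertSeps, List.foldr_cons, seq]
    have h : (when (mem (demand i.succ) source) (Action.insert cut (sep i))) n G ρ
        (update s cut t) = update s cut
          (if ρ source ∈ s (demand i.succ) then Insert.insert (ρ (sep i)) t else t) := by
      by_cases hi : ρ source ∈ s (demand i.succ) <;> simp [when, mem, Action.insert, hi]
    rw [h]
    refine (ih _).trans ?_
    congr 1
    ext w
    by_cases hi : ρ source ∈ s (demand i.succ)
    · simp [hi]
      grind
    · simp [hi]
      grind

/-- The cut that is described by the loop variables. -/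
def cutOf : Finset (Fin n) :=
  (({i | ρ source ∈ s (demand i.succ)} : Finset (Fin d)).image (ρ ∘ sep)).erase (ρ source)

theorem buildCut_apply : buildCut n G ρ s = update s cut (cutOf ρ s) := by
  rw [buildCut, seq, clear_apply, seq, insertSeps_apply]
  simp [Action.erase, cutOf]

theorem pass_apply (t : Finset (Fin n)) : pass n G ρ (update s reached t) =
    update s reached ((List.finRange n).foldl (fun t u => (List.finRange n).foldl (fun t w =>
      open Classical in if u ∈ t ∧ G.Adj u w ∧ w ∉ s cut then Insert.insert w t else t) t) t) := by
  refine foldl_update (f := fun s u => forEach head (when (and (mem reached tail)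
    (and (adj tail head) (not (mem cut head)))) (Action.insert reached head)) n G
      (update ρ tail u) s) (fun u t => foldl_update (f := fun s w => when (and (mem reached tail)
    (and (adj tail head) (not (mem cut head)))) (Action.insert reached head) n G
      (update (update ρ tail u) head w) s) (fun w t => ?_) _ _) _ _
  by_cases h : u ∈ t ∧ G.Adj u w ∧ w ∉ s cut
  · simp [when, mem, Test.and, Test.not, adj, Action.insert, h]
  · simp [when, mem, Test.and, Test.not, adj, h]

/-- After `n` passes the set is fixed, hence closed under every edge that avoids the cut.
Conversely, no pass leaves a closed set that contains the source. -/
theorem buildReached_apply :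
    buildReached n G ρ s = update s reached (reach G (s cut) (ρ source)) := by
  classical
  let step (u : Fin n) (t : Finset (Fin n)) (w : Fin n) : Finset (Fin n) :=
    if u ∈ t ∧ G.Adj u w ∧ w ∉ s cut then Insert.insert w t else t
  let row (t : Finset (Fin n)) (u : Fin n) : Finset (Fin n) := (List.finRange n).foldl (step u) t
  let f (t : Finset (Fin n)) : Finset (Fin n) := (List.finRange n).foldl row t
  have hstep : ∀ u t w, t ⊆ step u t w := by
    intro u t w
    dsimp only [step]
    split_ifs
    · exact Finset.subset_insert _ _
    · rfl
  have hrow : ∀ t u, t ⊆ row t u := fun t u => subset_foldl (hstep u) _ _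
  have hf : ∀ t, t ⊆ f t := fun t => subset_foldl hrow _ _
  have hpass : ∀ i t, pass n G (update ρ iter i) (update s reached t) = update s reached (f t) := by
    intro i t
    rw [pass_apply]
  have h := foldl_update (f := fun s i => pass n G (update ρ iter i) s) (s := s) (b := reached)
    (g := fun t _ => f t) hpass (List.finRange n) {ρ source}
  rw [buildReached, seq, clear_apply, seq, Action.insert, forEach]
  simp only [update_idem, update_self, insert_empty_eq]
  rw [h]
  congr 1
  rw [List.foldl_const, List.length_finRange]
  have hclosed := iterate_card_fixed hf {ρ source}
  rw [Fintype.card_fin] at hclosed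
  refine eq_reach ?_ ?_ ?_
  · have : ∀ k, ρ source ∈ f^[k] {ρ source} := by
      intro k
      induction k with
      | zero => simp
      | succ k ih =>
        rw [iterate_succ_apply']
        exact hf _ ih
    exact this n
  · intro u hu w huw hw
    have h₁ := eq_of_foldl_eq hrow hclosed (List.mem_finRange u)
    have h₂ := eq_of_foldl_eq (hstep u) h₁ (List.mem_finRange w)
    rw [← h₂]
    simp [step, hu, huw, hw]
  · intro T hv hT
    have hfT : ∀ t, t ⊆ T → f t ⊆ T := by
      refine fun t ht => foldl_subset (fun t u ht => foldl_subset (fun t w ht => ?_) _ ht) _ ht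
      dsimp only [step]
      split_ifs with h
      · exact Finset.insert_subset (hT u (ht h.1) w h.2.1 h.2.2) ht
      · exact ht
    have : ∀ k, f^[k] {ρ source} ⊆ T := by
      intro k
      induction k with
      | zero => simpa using hv
      | succ k ih =>
        rw [iterate_succ_apply']
        exact hfT _ ih
    exact this n

/-- The flag is a vertex set used as a Boolean: only membership of the source is ever read, so the
set itself stays unspecified. -/
theorem exists_setFlag_apply : ∃ t, setFlag n G ρ s = update s flag t ∧
    (ρ source ∈ t ↔ ρ source ∈ s (demand 0) ∧
      ∀ u ∈ s reached, u ∉ s solution ∧ u ∈ s part) := by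
  classical
  let C (u : Fin n) : Prop := u ∈ s reached ∧ ¬ (u ∉ s solution ∧ u ∈ s part)
  have h := foldl_update (f := fun s i => when (and (mem reached head)
      (not (and (not (mem solution head)) (mem part head)))) (erase flag source) n G
        (update ρ head i) s)
    (s := s) (b := flag) (g := fun t i => if C i then t.erase (ρ source) else t)
    (fun i t => by
      by_cases hi : C i
      · rw [if_pos hi]
        dsimp only [C] at hi
        simp only [when, Test.and, Test.not, mem, update_self, Action.erase]
        rw [if_pos (by simpa using hi)]
        simp
      · rw [if_neg hi]
        dsimp only [C] at hi
        simp only [when, Test.and, Test.not, mem, update_self]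
        rw [if_neg (by simpa using hi)])
    (List.finRange n)
  have h₁ : when (mem (demand 0) source) (Action.insert flag source) n G ρ (update s flag ∅) =
      update s flag (if ρ source ∈ s (demand 0) then {ρ source} else ∅) := by
    by_cases hi : ρ source ∈ s (demand 0) <;> simp [when, mem, Action.insert, hi]
  refine ⟨(List.finRange n).foldl (fun t i => if C i then t.erase (ρ source) else t)
    (if ρ source ∈ s (demand 0) then {ρ source} else ∅), ?_, ?_⟩
  · rw [setFlag, seq, clear_apply, seq, h₁]
    exact h _
  · have key : ∀ (l : List (Fin n)) (t : Finset (Fin n)),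
        ρ source ∈ l.foldl (fun t i => if C i then t.erase (ρ source) else t) t ↔
          ρ source ∈ t ∧ ∀ u ∈ l, ¬ C u := by
      intro l
      induction l with
      | nil => simp
      | cons i l ih =>
        intro t
        rw [List.foldl_cons, ih]
        by_cases hi : C i <;> simp [hi]
    rw [key]
    refine and_congr ?_ ?_
    · by_cases hi : ρ source ∈ s (demand 0) <;> simp [hi]
    · simp only [List.mem_finRange, forall_const, C]
      refine forall_congr' fun u => ?_
      tauto

end Semantics

end Program

end

end VectorConnectivity

/-! ### Correctness of the search for minimal cuts -/

namespace VectorConnectivity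

open Function StackProgram

noncomputable section

variable {d : ℕ}

namespace Program

open Action Test LoopVar SetVar

section Invariant

variable {n : ℕ} (G : SimpleGraph (Fin n)) (φ : Fin n → ℕ) (S : Finset (Fin n))

theorem forEach_induction {ι κ : Type} [DecidableEq ι] {f : Action ι κ} {x : ι} {ρ : ι → Fin n}
    {I : (κ → Finset (Fin n)) → Prop} (hf : ∀ ρ s, I s → I (f n G ρ s)) {s : κ → Finset (Fin n)}
    (hs : I s) : I (forEach x f n G ρ s) := by
  rw [forEach]
  generalize List.finRange n = l
  induction l generalizing s with
  | nil => exact hs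
  | cons i l ih => exact ih (hf _ _ hs)

/-- Iterations before `i` need to keep only `I`; iteration `i` produces `Q`, and the later ones keep
it. -/
theorem forEach_establishes {ι κ : Type} [DecidableEq ι] {f : Action ι κ} {x : ι} {ρ : ι → Fin n}
    {I Q : (κ → Finset (Fin n)) → Prop} (hf : ∀ ρ s, I s → I (f n G ρ s))
    (hQ : ∀ ρ s, I s → Q s → Q (f n G ρ s)) (i : Fin n)
    (hi : ∀ s, I s → Q (f n G (update ρ x i) s)) {s : κ → Finset (Fin n)} (hs : I s) :
    Q (forEach x f n G ρ s) := by
  have h₁ : ∀ (l : List (Fin n)) (s), I s → Q s →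
      Q (l.foldl (fun s i => f n G (update ρ x i) s) s) := by
    intro l
    induction l with
    | nil => exact fun s _ h => h
    | cons j l ih => exact fun s hI hQs => ih _ (hf _ _ hI) (hQ _ _ hI hQs)
  have h₂ : ∀ (l : List (Fin n)) (s), i ∈ l → I s →
      Q (l.foldl (fun s i => f n G (update ρ x i) s) s) := by
    intro l
    induction l with
    | nil => exact fun s h => absurd h (by simp)
    | cons j l ih =>
      intro s h hI
      rcases List.mem_cons.1 h with rfl | h
      · exact h₁ l _ (hf _ _ hI) (hi _ hI)
      · exact ih _ h (hf _ _ hI)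
  exact h₂ _ _ (List.mem_finRange i) hs

/-- The sets that represent the demands. -/
def HasDemand (s : SetVar d → Finset (Fin n)) : Prop :=
  ∀ (i : Fin (d + 1)) v, v ∈ s (demand i) ↔ (i : ℕ) < φ v

/-- The state during the search for a minimal cut. -/
structure Searching (s : SetVar d → Finset (Fin n)) : Prop where
  hasDemand : HasDemand φ s
  solution_eq : s solution = S
  cases : (s payment = ∅ ∧ s part = Finset.univ) ∨
    ∃ v Z, IsCut G φ S v Z ∧ s part = reach G Z v ∧ s payment = Insert.insert v Z

/-- The cut `v`, `Z` does not improve on the part that has been found. -/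
def Beaten (v : Fin n) (Z : Finset (Fin n)) (s : SetVar d → Finset (Fin n)) : Prop :=
  (s payment).Nonempty ∧ (reach G Z v ⊆ s part → s part ⊆ reach G Z v)

variable {G φ S} {s : SetVar d → Finset (Fin n)} (ρ : LoopVar d → Fin n)

/-- The vertex `sep i` is used only if `i + 1 < φ (ρ source)`, which leaves at most `φ (ρ source) -
1` indices. Positivity of the demand makes this a strict inequality. -/
theorem card_cutOf_lt (hs : HasDemand φ s) (h : 0 < φ (ρ source)) :
    (cutOf ρ s).card < φ (ρ source) := by
  have h₁ : (cutOf ρ s).card ≤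
      (({i | ρ source ∈ s (demand i.succ)} : Finset (Fin d))).card :=
    (Finset.card_le_card (Finset.erase_subset _ _)).trans Finset.card_image_le
  have h₂ : (({i | ρ source ∈ s (demand i.succ)} : Finset (Fin d))).card ≤
      (Finset.range (φ (ρ source) - 1)).card := by
    refine Finset.card_le_card_of_injOn (fun i => (i : ℕ)) (fun i hi => ?_)
      Fin.val_injective.injOn
    have := (hs i.succ (ρ source)).1 (by simpa using hi)
    rw [Fin.val_succ] at this
    simp
    omega
  rw [Finset.card_range] at h₂
  omega

theorem isCut_cutOf_iff (hs : HasDemand φ s) :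
    IsCut G φ S (ρ source) (cutOf ρ s) ↔ ρ source ∈ s (demand 0) ∧
      Disjoint (reach G (cutOf ρ s) (ρ source)) S := by
  rw [hs]
  constructor
  · exact fun h => ⟨(Nat.zero_le _).trans_lt h.card_lt, h.disjoint⟩
  · exact fun h => ⟨Finset.notMem_erase _ _, card_cutOf_lt ρ hs h.1, h.2⟩

theorem exists_cutOf_eq (hs : HasDemand φ s) (hd : ∀ v, φ v ≤ d) {v : Fin n} {Z : Finset (Fin n)}
    (hv : v ∉ Z) (hZ : Z.card < φ v) : ∃ z : Fin d → Fin n, ∀ ρ : LoopVar d → Fin n,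
      ρ source = v → (∀ i, ρ (sep i) = z i) → cutOf ρ s = Z := by
  -- The variables beyond the list of `Z` receive the source, which is erased from the cut
  -- afterwards.
  refine ⟨fun i => Z.toList.getD i v, fun ρ hρ hz => ?_⟩
  ext w
  simp only [cutOf, Finset.mem_erase, Finset.mem_image, Finset.mem_filter_univ, comp_apply, hz, hρ,
    hs _ _, Fin.val_succ]
  constructor
  · rintro ⟨hw, i, -, rfl⟩
    by_cases hi : (i : ℕ) < Z.toList.length
    · rw [List.getD_eq_getElem _ _ hi]
      exact Finset.mem_toList.1 (List.getElem_mem _)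
    · exact absurd (List.getD_eq_default _ _ (not_lt.1 hi)) hw
  · intro hw
    refine ⟨fun h => hv (h ▸ hw), ?_⟩
    obtain ⟨i, hi, rfl⟩ := List.mem_iff_getElem.1 (Finset.mem_toList.2 hw)
    have hi' : i < Z.card := by simpa using hi
    have := hd v
    exact ⟨⟨i, by omega⟩, by simp only; omega, List.getD_eq_getElem _ _ hi⟩

/-- The effect of one attempt. -/
theorem attempt_spec (hs : HasDemand φ s) (hS : s solution = S) :
    HasDemand φ (attempt n G ρ s) ∧ attempt n G ρ s solution = S ∧
    (IsCut G φ S (ρ source) (cutOf ρ s) ∧ reach G (cutOf ρ s) (ρ source) ⊆ s part ∧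
        attempt n G ρ s part = reach G (cutOf ρ s) (ρ source) ∧
        attempt n G ρ s payment = Insert.insert (ρ source) (cutOf ρ s) ∨
      ¬ (IsCut G φ S (ρ source) (cutOf ρ s) ∧ reach G (cutOf ρ s) (ρ source) ⊆ s part) ∧
        attempt n G ρ s part = s part ∧ attempt n G ρ s payment = s payment) := by
  rw [attempt, seq, buildCut_apply, seq, buildReached_apply, seq]
  obtain ⟨t, ht, hmem⟩ := exists_setFlag_apply G ρ (update (update s cut (cutOf ρ s)) reached
    (reach G (update s cut (cutOf ρ s) cut) (ρ source)))
  rw [ht]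
  have hiff : ρ source ∈ t ↔ IsCut G φ S (ρ source) (cutOf ρ s) ∧
      reach G (cutOf ρ s) (ρ source) ⊆ s part := by
    rw [hmem, isCut_cutOf_iff ρ hs, Finset.disjoint_left, ← hS, and_assoc]
    simp [forall_and, Finset.subset_iff]
  by_cases h : ρ source ∈ t
  · rw [when, if_pos (by simpa [mem] using h), improve, seq, assign_apply _ _ _ (by simp), seq,
      assign_apply _ _ _ (by simp)]
    refine ⟨fun i v => ?_, ?_, .inl ⟨(hiff.1 h).1, (hiff.1 h).2, ?_, ?_⟩⟩
    · simp [Action.insert, hs i v]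
    · simp [Action.insert, hS]
    · simp [Action.insert]
    · simp [Action.insert]
  · rw [when, if_neg (by simpa [mem] using h)]
    refine ⟨fun i v => ?_, ?_, .inr ⟨fun h' => h (hiff.2 h'), ?_, ?_⟩⟩
    · simp [hs i v]
    · simp [hS]
    · simp
    · simp

theorem Searching.attempt (hs : Searching G φ S s) : Searching G φ S (attempt n G ρ s) := by
  obtain ⟨h₁, h₂, h₃⟩ := attempt_spec (G := G) ρ hs.hasDemand hs.solution_eq
  refine ⟨h₁, h₂, ?_⟩
  rcases h₃ with ⟨hc, -, hp, hq⟩ | ⟨-, hp, hq⟩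
  · exact .inr ⟨_, _, hc, hp, hq⟩
  · rw [hp, hq]
    exact hs.cases

/-- The part found only ever shrinks. A set inside the new part is inside the old one, so it
contains the old part and with it the new one. Hence one run through all candidates ends with a
minimal part. -/
theorem Beaten.attempt (hs : Searching G φ S s) {v : Fin n} {Z : Finset (Fin n)}
    (h : Beaten G v Z s) : Beaten G v Z (attempt n G ρ s) := by
  obtain ⟨-, -, h₃⟩ := attempt_spec (G := G) ρ hs.hasDemand hs.solution_eq
  rw [Beaten]
  rcases h₃ with ⟨-, hsub, hp, hq⟩ | ⟨-, hp, hq⟩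
  · rw [hp, hq]
    exact ⟨Finset.insert_nonempty _ _, fun h' => hsub.trans (h.2 (h'.trans hsub))⟩
  · rw [hp, hq]
    exact h

/-- An accepted cut becomes the part itself. A rejected one is not contained in the part, so the
comparison is vacuous; and some cut has been found already, since the initial part `Finset.univ`
rejects nothing. -/
theorem beaten_attempt (hs : Searching G φ S s) (hc : IsCut G φ S (ρ source) (cutOf ρ s)) :
    Beaten G (ρ source) (cutOf ρ s) (Program.attempt n G ρ s) := by
  obtain ⟨-, -, h₃⟩ := attempt_spec (G := G) ρ hs.hasDemand hs.solution_eq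
  rw [Beaten]
  rcases h₃ with ⟨-, hsub, hp, hq⟩ | ⟨hn, hp, hq⟩
  · rw [hp, hq]
    exact ⟨Finset.insert_nonempty _ _, fun _ => le_rfl⟩
  · rw [hp, hq]
    refine ⟨?_, fun h => absurd ⟨hc, h⟩ hn⟩
    rcases hs.cases with ⟨-, hu⟩ | ⟨v, Z, -, -, h⟩
    · exact absurd ⟨hc, hu ▸ Finset.subset_univ _⟩ hn
    · rw [h]
      exact Finset.insert_nonempty _ _

theorem Searching.allSeps (l : List (Fin d)) (hs : Searching G φ S s) :
    Searching G φ S (allSeps l n G ρ s) := by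
  induction l generalizing ρ s with
  | nil => exact hs.attempt ρ
  | cons i l ih => exact forEach_induction (f := Program.allSeps l) G (fun ρ s h => ih ρ h) hs

theorem Beaten.allSeps (l : List (Fin d)) (hs : Searching G φ S s) {v : Fin n}
    {Z : Finset (Fin n)} (h : Beaten G v Z s) : Beaten G v Z (allSeps l n G ρ s) := by
  induction l generalizing ρ s with
  | nil => exact h.attempt ρ hs
  | cons i l ih =>
    exact (forEach_induction (f := Program.allSeps l) (I := fun s => Searching G φ S s ∧
      Beaten G v Z s) G (fun ρ s h => ⟨h.1.allSeps ρ l, ih ρ h.1 h.2⟩) ⟨hs, h⟩).2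

/-- Follows the branch of the nested loops in which each `sep i` takes the value `z i`. Variables
outside `l` already have their values, so the innermost attempt tries exactly `Z`; the remaining
branches preserve the outcome. -/
theorem beaten_allSeps (l : List (Fin d)) (hs : Searching G φ S s) {v : Fin n}
    {Z : Finset (Fin n)} (hc : IsCut G φ S v Z) (z : Fin d → Fin n)
    (hz : ∀ ρ : LoopVar d → Fin n, ρ source = v → (∀ i, ρ (sep i) = z i) →
      ∀ s, Searching G φ S s → cutOf ρ s = Z)
    (hρ : ρ source = v) (hl : ∀ i ∉ l, ρ (sep i) = z i) :
    Beaten G v Z (allSeps l n G ρ s) := by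
  induction l generalizing ρ s with
  | nil =>
    have := hz ρ hρ (fun i => hl i (by simp)) s hs
    have h := beaten_attempt ρ hs (by rwa [hρ, this])
    rwa [hρ, this] at h
  | cons i l ih =>
    refine forEach_establishes (f := Program.allSeps l) G
      (fun ρ s (h : Searching G φ S s) => h.allSeps ρ l)
      (fun ρ s hs h => h.allSeps ρ l hs) (z i) (fun s hs => ih _ hs ?_ ?_) hs
    · simpa using hρ
    · intro j hj
      by_cases hji : j = i
      · simp [hji]
      · simpa [hji] using hl j (by simp [hji, hj])

/-- One round adds a minimal cut to the solution. -/
theorem oneRound_spec (hd : ∀ v, φ v ≤ d) (hs : HasDemand φ s) :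
    HasDemand φ (oneRound n G ρ s) ∧ ∃ X P, IsMinimalCut G φ (s solution) X P ∧
      oneRound n G ρ s solution = s solution ∪ P := by
  rw [oneRound, seq, seq, seq, fill_apply, clear_apply, addTo_apply _ _ _ (by simp)]
  set s₀ := update (update s part Finset.univ) payment ∅ with hs₀
  have h₀ : Searching G φ (s solution) s₀ := by
    refine ⟨fun i v => ?_, ?_, .inl ⟨?_, ?_⟩⟩
    · simp [hs₀, hs i v]
    · simp [hs₀]
    · simp [hs₀]
    · simp [hs₀]
  set s₁ := forEach source (Program.allSeps (List.finRange d)) n G ρ s₀ with hs₁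
  have h₁ : Searching G φ (s solution) s₁ :=
    forEach_induction G (fun ρ s h => h.allSeps ρ _) h₀
  have hall : ∀ v Z, IsCut G φ (s solution) v Z → Beaten G v Z s₁ := by
    intro v Z hc
    obtain ⟨z, hz⟩ := exists_cutOf_eq hs hd hc.notMem hc.card_lt
    have hz' : ∀ ρ : LoopVar d → Fin n, ρ source = v → (∀ i, ρ (sep i) = z i) →
        ∀ s', Searching G φ (s solution) s' → cutOf ρ s' = Z := by
      intro ρ h h' s' hs'
      rw [← hz ρ h h', cutOf, cutOf]
      simp only [hs'.hasDemand _ _, hs _ _]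
    exact forEach_establishes G (fun ρ s (h : Searching G φ _ s) => h.allSeps ρ _)
      (fun ρ s hs h => h.allSeps ρ _ hs) v
      (fun s hs => beaten_allSeps _ _ hs hc z hz' (by simp) (by simp)) h₀
  refine ⟨fun i v => ?_, s₁ part, s₁ payment, ?_, ?_⟩
  · simp [h₁.hasDemand i v]
  · rcases h₁.cases with ⟨hp, -⟩ | ⟨v, Z, hc, hX, hP⟩
    · refine .inl ⟨hp, fun v Z hc => ?_⟩
      -- An empty payment means that there is no cut at all, as any cut would have been beaten by a
      -- nonempty payment.
      have := (hall v Z hc).1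
      simp [hp] at this
    · exact .inr ⟨v, Z, hc, hX, hP, fun v' Z' hc' => (hall v' Z' hc').2⟩
  · simp [h₁.solution_eq]

/-- The algorithm finds a vector connectivity set with a good packing. -/
theorem approximate_spec (hd : ∀ v, φ v ≤ d) (hs : HasDemand φ s) (hS : s solution = ∅) :
    Packed G φ d (approximate n G ρ s solution) ∧
      ∀ v Z, ¬ IsCut G φ (approximate n G ρ s solution) v Z := by
  -- The sequence of states is continued beyond round `n` with an arbitrary assignment, so that it
  -- is defined for all `k`.
  let ρ' (k : ℕ) : LoopVar d → Fin n :=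
    if hk : k < n then update ρ round ⟨k, hk⟩ else ρ
  let a (k : ℕ) : SetVar d → Finset (Fin n) := k.rec s fun k s => oneRound n G (ρ' k) s
  have ha : ∀ k, a (k + 1) = oneRound n G (ρ' k) (a k) := fun _ => rfl
  have hfold : ∀ k ≤ n, ((List.finRange n).take k).foldl
      (fun s i => oneRound n G (update ρ round i) s) s = a k := by
    intro k
    induction k with
    | zero => exact fun _ => rfl
    | succ k ih =>
      intro hk
      rw [List.take_succ_eq_append_getElem (by simpa using hk), List.foldl_append,
        ih (by omega), ha]
      simp [ρ', show k < n from hk]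
  have happrox : approximate n G ρ s = a n := by
    rw [← hfold n le_rfl, List.take_of_length_le (by simp)]
    rfl
  have hdem : ∀ k, HasDemand φ (a k) := by
    intro k
    induction k with
    | zero => exact hs
    | succ k ih =>
      rw [ha]
      exact (oneRound_spec (ρ' k) hd ih).1
  choose X P hmin hstep using fun k => (oneRound_spec (G := G) (ρ' k) hd (hdem k)).2
  have hpacked : ∀ k, Packed G φ d (a k solution) := by
    intro k
    induction k with
    | zero =>
      change Packed G φ d (s solution)
      rw [hS]
      exact packed_empty
    | succ k ih =>
      rw [ha, hstep]
      exact ih.union hd (hmin k)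
  rw [happrox]
  refine ⟨hpacked n, fun v Z => ?_⟩
  have := not_isCut_of_minimalCuts (A := fun k => a k solution) (P := P) (X := X) (v := v)
    (fun k => by rw [ha, hstep]) hmin Z
  rwa [Fintype.card_fin] at this

end Invariant

end Program

end

end VectorConnectivity

/-! ### Reading the input and cleaning up the stacks -/

namespace StackProgram

open Function

section InputOutput

variable {ι κ α : Type} [DecidableEq ι] [DecidableEq κ]

theorem Exec.lift_congr {c : Cmd (Letter ι κ α)} {M : ∀ k, List (Letter ι κ α k)} {inp : List α}
    {m m' : Stk ι κ → List Bool} {t : ℕ} (h : Exec c M (lift inp m) t) (hm : m = m') :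
    Exec c M (lift inp m') t := by
  rwa [← hm]

/-- Push the symbols that `e` prescribes to some of the binary stacks. -/
def pushEach (e : Stk ι κ → Option Bool) (l : List (Stk ι κ)) : Cmd (Letter ι κ α) :=
  l.foldr (fun b c => match e b with
    | none => c
    | some x => .seq (.push (some b) x) c) .skip

theorem exec_pushEach (e : Stk ι κ → Option Bool) {l : List (Stk ι κ)} (hl : l.Nodup)
    (inp : List α) (m : Stk ι κ → List Bool) :
    ∃ t ≤ l.length + 1, Exec (pushEach e l) (lift inp m)
      (lift inp fun b => if b ∈ l then (e b).toList ++ m b else m b) t := by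
  induction l generalizing m with
  | nil => exact ⟨1, by simp, by simpa [pushEach] using Exec.skip _⟩
  | cons b l ih =>
    obtain ⟨hb, hl⟩ := List.nodup_cons.1 hl
    rw [pushEach, List.foldr_cons]
    rcases he : e b with _ | x
    · obtain ⟨t, ht, h⟩ := ih hl m
      refine ⟨t, by rw [List.length_cons]; omega, ?_⟩
      refine Exec.lift_congr h ?_
      funext b'
      rcases eq_or_ne b' b with rfl | hne
      · simp [he, hb]
      · simp [hne]
    · obtain ⟨t, ht, h⟩ := ih hl (update m b (x :: m b))
      have hp := Exec.push (Γ := Letter ι κ α) (some b) x (lift inp m)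
      rw [update_lift_some] at hp
      refine ⟨1 + t, by rw [List.length_cons]; omega, ?_⟩
      refine Exec.lift_congr (hp.seq h) ?_
      funext b'
      rcases eq_or_ne b' b with rfl | hne
      · simp [he, hb]
      · simp [hne]

variable [Fintype ι] [Fintype κ]

/-- Distribute the input to the binary stacks. -/
noncomputable def decode (e : Stk ι κ → α → Option Bool) : Cmd (Letter ι κ α) :=
  .loop none (fun _ => false) fun a => pushEach (fun b => e b a) Finset.univ.toList

theorem exec_decode (e : Stk ι κ → α → Option Bool) (inp : List α) (m : Stk ι κ → List Bool) :
    ∃ t ≤ inp.length * (Fintype.card (Stk ι κ) + 2) + 1, Exec (decode e) (lift inp m)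
      (lift [] fun b => (inp.filterMap (e b)).reverse ++ m b) t := by
  induction inp generalizing m with
  | nil => exact ⟨1, by simp, .loop_nil (k := none) rfl⟩
  | cons a inp ih =>
    obtain ⟨t, ht, h⟩ := exec_pushEach (fun b => e b a) (Finset.nodup_toList Finset.univ) inp m
    obtain ⟨t', ht', h'⟩ := ih (fun b => if b ∈ Finset.univ.toList then (e b a).toList ++ m b else m b)
    rw [Finset.length_toList, Finset.card_univ] at ht
    refine ⟨1 + (t + t'), ?_, ?_⟩
    · rw [List.length_cons, Nat.succ_mul]
      omega
    · rw [← update_lift_none (a :: inp) inp m] at h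
      have := Exec.loop_step (Γ := Letter ι κ α) (k := none) (halts := fun _ => false)
        (c := fun a => pushEach (fun b => e b a) Finset.univ.toList) (m := lift (a :: inp) m)
        (a := a) (l := inp) rfl rfl h h'
      refine Exec.lift_congr this ?_
      funext b
      rcases hb : e b a with _ | x <;> simp [hb]

/-- Empty some of the binary stacks. -/
def drain (l : List (Stk ι κ)) : Cmd (Letter ι κ α) :=
  l.foldr (fun b c => .seq (.loop (some b) (fun _ => false) fun _ => .skip) c) .skip

omit [Fintype ι] [Fintype κ] in
theorem Run.drain_one (b : Stk ι κ) (m : Stk ι κ → List Bool) :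
    Run (.loop (some b) (fun _ => false) fun _ => .skip : Cmd (Letter ι κ α)) m (update m b [])
      (2 * (m b).length + 1) := by
  generalize hl : m b = l
  induction l generalizing m with
  | nil =>
    refine ⟨1, by simp, ?_⟩
    rw [← hl, update_eq_self]
    exact .loop_nil (k := some b) hl
  | cons x l ih =>
    obtain ⟨t, ht, h⟩ := ih (update m b l) (by simp)
    rw [update_idem] at h
    have hs := Exec.skip (Γ := Letter ι κ α) (lift [] (update m b l))
    rw [← update_lift_some] at hs h
    refine ⟨1 + (1 + t), by rw [List.length_cons]; omega, ?_⟩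
    exact Exec.loop_step (Γ := Letter ι κ α) (k := some b) (a := x) (l := l) hl rfl hs h

omit [Fintype ι] [Fintype κ] in
theorem Run.drain (l : List (Stk ι κ)) {m : Stk ι κ → List Bool} {B : ℕ}
    (hB : ∀ b, (m b).length ≤ B) :
    Run (drain l : Cmd (Letter ι κ α)) m (fun b => if b ∈ l then [] else m b)
      (l.length * (2 * B + 1) + 1) := by
  induction l generalizing m with
  | nil => exact (Run.skip.mono (by simp)).congr rfl (by simp)
  | cons b l ih =>
    refine (((Run.drain_one b m).seq (ih (m := update m b []) fun b' => ?_)).mono ?_).congr rfl ?_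
    · rcases eq_or_ne b' b with rfl | hne
      · simp
      · simpa [hne] using hB b'
    · have := hB b
      rw [List.length_cons, Nat.add_mul, one_mul]
      generalize l.length * (2 * B + 1) = e
      omega
    · funext b'
      rcases eq_or_ne b' b with rfl | hne
      · simp
      · simp [hne]

end InputOutput

theorem eval_mono (p : Polynomial ℕ) {a b : ℕ} (h : a ≤ b) : p.eval a ≤ p.eval b := by
  rw [Polynomial.eval_eq_sum_range, Polynomial.eval_eq_sum_range]
  gcongr

instance Letter.fintype {ι κ α : Type} [Fintype α] : ∀ k, Fintype (Letter ι κ α k)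
  | none => inferInstanceAs (Fintype α)
  | some _ => inferInstanceAs (Fintype Bool)

end StackProgram

/-! ### The complete program and its running time -/

namespace VectorConnectivity

open Function StackProgram

noncomputable section

variable {d : ℕ}

open Program LoopVar SetVar

/-- The bit that a symbol of the description of an instance contributes to a binary stack. -/
def inputBit : Stk (LoopVar d) (SetVar d) → Fin (d + 1) ⊕ Bool → Option Bool
  | .size, .inl _ => some true
  | .array (demand i), .inl k => some (decide (i < k))
  | .array _, .inl _ => some false
  | .matrix, .inr b => some b
  | _, _ => none

/-- The markers below the numbers that are represented in unary. -/
def markers : Stk (LoopVar d) (SetVar d) → Option Bool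
  | .size => some false
  | .var _ => some false
  | _ => none

/-- The sets with which the algorithm starts. -/
def initialSets (I : VectorConnectivityInstance d) : SetVar d → Finset (Fin I.n)
  | demand i => {v | i < I.demand v}
  | _ => ∅

/-- The output of the approximation algorithm. -/
def approximation (I : VectorConnectivityInstance d) : Finset (Fin I.n) :=
  if h : 0 < I.n then
    approximate I.n I.graph (fun _ => ⟨I.n - 1, by omega⟩) (initialSets I) solution
  else ∅

theorem length_encode (I : VectorConnectivityInstance d) :
    I.encode.length = I.n + I.n * I.n := by
  simp [VectorConnectivityInstance.encode, List.length_product]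

-- Pushing the input symbol by symbol reverses it, in accordance with `config`. A loop variable
-- starts with its delimiter alone, the unary number zero, which represents the vertex `n - 1`; this
-- explains the initial assignment.
open Classical in
theorem filterMap_encode (I : VectorConnectivityInstance d) (hn : 0 < I.n)
    (b : Stk (LoopVar d) (SetVar d)) :
    (I.encode.filterMap (inputBit b)).reverse ++ (markers b).toList =
      config I.graph (fun _ => ⟨I.n - 1, by omega⟩) (initialSets I) (fun _ => []) [] b := by
  cases b with
  | array a =>
    cases a <;> simp [VectorConnectivityInstance.encode, inputBit, markers, config, initialSets, Function.comp_def,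
      List.filterMap_append, List.filterMap_map, List.filterMap_eq_map']
  | _ => simp [VectorConnectivityInstance.encode, inputBit, markers, config, Function.comp_def,
      List.filterMap_append, List.filterMap_map, List.filterMap_eq_map']

theorem length_config_le {n : ℕ} (G : SimpleGraph (Fin n)) [DecidableRel G.Adj]
    (ρ : LoopVar d → Fin n) (s : SetVar d → Finset (Fin n)) (b : Stk (LoopVar d) (SetVar d)) :
    (config G ρ s (fun _ => []) [] b).length ≤ n * n + n + 1 := by
  cases b <;> simp [config, List.length_product] <;> omega

theorem isPolynomialTime_approximation :
    IsPolynomialTime (approximation : ∀ I : VectorConnectivityInstance d, Finset (Fin I.n)) := by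
  obtain ⟨c, p, hc⟩ := isPoly_approximate (d := d) (Fin (d + 1) ⊕ Bool)
  -- The machine must halt with every stack but the output empty.
  let others : List (Stk (LoopVar d) (SetVar d)) := (Finset.univ.erase .output).toList
  let work : Cmd (Letter (LoopVar d) (SetVar d) (Fin (d + 1) ⊕ Bool)) :=
    .seq (pushEach markers Finset.univ.toList) <| .seq (decode inputBit) <| .seq c <|
      -- Pouring reverses the solution, which turns the reversed membership bits into the required
      -- order.
      .seq (pour (.array solution) .output) (drain others)
  let prog : Cmd (Letter (LoopVar d) (SetVar d) (Fin (d + 1) ⊕ Bool)) :=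
    -- The empty graph has no vertex that a loop variable could hold, so empty input is treated
    -- apart; otherwise the popped symbol is put back.
    .case none fun o => match o with
      | none => .skip
      | some a => .seq (.push none a) work
  let N := Fintype.card (Stk (LoopVar d) (SetVar d))
  -- The summands bound the phases in order: testing the input, placing the markers, decoding, the
  -- algorithm, the output and the clean-up. The number of vertices is bounded by the length of the
  -- input throughout.
  let q : Polynomial ℕ := 2 + ((N + 1 : ℕ) + ((.X * (N + 2 : ℕ) + 1) + (p + ((2 * .X + 1) +
    ((others.length : ℕ) * (2 * (.X * .X + .X + 1) + 1) + 1)))))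
  refine ⟨polyTimeOfExec prog none (some .output)
    VectorConnectivityInstance.encode
    (fun I => encodeVertexSet (approximation I)) q fun I => ?_⟩
  classical
  have hstart : update (fun _ => [] : ∀ k, List (Letter (LoopVar d) (SetVar d)
      (Fin (d + 1) ⊕ Bool) k)) none I.encode =
      lift I.encode fun _ : Stk (LoopVar d) (SetVar d) => [] := by
    funext k
    rcases k with _ | k <;> rfl
  have hend (l : List Bool) :
      update (fun _ => [] : ∀ k, List (Letter (LoopVar d) (SetVar d) (Fin (d + 1) ⊕ Bool) k))
        (some .output) l = lift [] (update (fun _ => []) .output l) := by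
    rw [← update_lift_some]
    congr 1
    funext k
    rcases k with _ | k <;> rfl
  rcases Nat.eq_zero_or_pos I.n with hn | hn
  · have hin : I.encode = [] := List.eq_nil_of_length_eq_zero (by simp [length_encode, hn])
    have hout : encodeVertexSet (approximation I) = [] :=
      List.eq_nil_of_length_eq_zero (by simp [encodeVertexSet, hn])
    rw [hout, hin]
    refine ⟨1 + 1, by simp [q], ?_⟩
    rw [update_eq_self_iff.2 rfl, update_eq_self_iff.2 rfl]
    have := Exec.skip (Γ := Letter (LoopVar d) (SetVar d) (Fin (d + 1) ⊕ Bool))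
      (update (fun _ => []) none [])
    rw [update_eq_self_iff.2 rfl] at this
    refine Exec.case (k := none) ?_
    rw [List.tail_nil, update_eq_self_iff.2 rfl]
    exact this
  · obtain ⟨t₁, ht₁, h₁⟩ := exec_pushEach (markers (d := d)) (Finset.nodup_toList Finset.univ)
      I.encode (fun _ => [])
    obtain ⟨t₂, ht₂, h₂⟩ := exec_decode (inputBit (d := d)) I.encode
      (fun b => if b ∈ Finset.univ.toList then (markers b).toList ++ [] else [])
    have hconf : (fun b => (I.encode.filterMap (inputBit b)).reverse ++
        if b ∈ Finset.univ.toList then (markers b).toList ++ [] else []) =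
          config I.graph (fun _ => ⟨I.n - 1, by omega⟩) (initialSets I) (fun _ => []) [] := by
      funext b
      rw [← filterMap_encode I hn b]
      simp
    rw [hconf] at h₂
    obtain ⟨t₃, ht₃, h₃⟩ := hc I.n I.graph (fun _ => ⟨I.n - 1, by omega⟩) (initialSets I)
      (fun _ => []) []
    set s' := approximate I.n I.graph (fun _ => ⟨I.n - 1, by omega⟩) (initialSets I) with hs'
    set m := config I.graph (fun _ => ⟨I.n - 1, by omega⟩) s' (fun _ => []) [] with hm
    obtain ⟨t₄, ht₄, h₄⟩ := Run.pour (α := Fin (d + 1) ⊕ Bool) (m := m)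
      (a := .array solution) (b := .output) (by simp)
    set m' := update (update m .output ((m (.array solution)).reverse ++ m .output))
      (.array solution) [] with hm'
    have hm'_le : ∀ b, (m' b).length ≤ I.n * I.n + I.n + 1 := by
      intro b
      have := length_config_le I.graph (fun _ => ⟨I.n - 1, by omega⟩) s' b
      rw [← hm] at this
      rw [hm', update_apply, update_apply]
      split_ifs
      · simp
      · simp [hm, config]
        omega
      · exact this
    obtain ⟨t₅, ht₅, h₅⟩ := Run.drain (α := Fin (d + 1) ⊕ Bool) others hm'_le
    have hfin : (fun b => if b ∈ others then [] else m' b) =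
        update (fun _ => []) .output (encodeVertexSet (approximation I)) := by
      funext b
      rcases eq_or_ne b .output with rfl | hb
      · simp [others, hm', hm, config, encodeVertexSet, approximation, hn, hs']
      · simp [others, hb]
    rw [hfin] at h₅
    rw [hstart, hend]
    have hwork := h₁.seq (h₂.seq (h₃.seq (h₄.seq h₅)))
    obtain ⟨a, l, hal⟩ : ∃ a l, I.encode = a :: l :=
      List.exists_cons_of_length_pos (by rw [length_encode]; omega)
    refine ⟨1 + (1 + (t₁ + (t₂ + (t₃ + (t₄ + t₅))))), ?_, ?_⟩
    · have hle : I.n ≤ I.encode.length := by rw [length_encode]; omega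
      have hp := eval_mono p hle
      have hlen : (m (.array solution)).length = I.n := by simp [hm, config]
      rw [hlen] at ht₄
      have hsq : others.length * (2 * (I.n * I.n + I.n + 1) + 1) ≤
          others.length * (2 * (I.encode.length * I.encode.length + I.encode.length + 1) + 1) := by
        gcongr
      rw [Finset.length_toList, Finset.card_univ] at ht₁
      simp only [q, N, Polynomial.eval_add, Polynomial.eval_mul, Polynomial.eval_X,
        Polynomial.eval_natCast, Polynomial.eval_ofNat, Polynomial.eval_one]
      simp only [Nat.cast_id]
      omega
    · rw [hal] at hwork ⊢
      have hpush := Exec.push (Γ := Letter (LoopVar d) (SetVar d) (Fin (d + 1) ⊕ Bool)) none a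
        (lift l fun _ => [])
      rw [update_lift_none] at hpush
      refine Exec.case (k := none) ?_
      rw [update_lift_none]
      exact hpush.seq hwork

end

end VectorConnectivity

theorem mainTheorem1 (d : ℕ) :
    ∃ A : ∀ I : VectorConnectivityInstance d, Finset (Fin I.n),
      IsPolynomialTime A ∧
      ∀ I : VectorConnectivityInstance d,
        I.IsVectorConnectivitySet (A I) ∧ (A I).card ≤ d * I.opt := by
  refine ⟨VectorConnectivity.approximation, VectorConnectivity.isPolynomialTime_approximation, fun I => ?_⟩
  obtain ⟨S, hS, hcard⟩ := I.exists_card_eq_opt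
  rcases Nat.eq_zero_or_pos I.n with hn | hn
  · have : IsEmpty (Fin I.n) := by rw [hn]; infer_instance
    exact ⟨fun v => isEmptyElim v, by simp [Finset.eq_empty_of_isEmpty]⟩
  · obtain ⟨hpack, hcut⟩ := VectorConnectivity.Program.approximate_spec (φ := fun v => (I.demand v : ℕ))
      (G := I.graph) (s := VectorConnectivity.initialSets I) (d := d) (fun _ => ⟨I.n - 1, by omega⟩)
      (fun v => Nat.lt_succ_iff.1 (I.demand v).2)
      (fun i v => by simp [VectorConnectivity.initialSets]) rfl
    rw [VectorConnectivity.approximation, dif_pos hn]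
    refine ⟨fun v hv => VectorConnectivity.hasDisjointPaths_of_forall_not_isCut hcut hv, ?_⟩
    rw [← hcard]
    exact hpack.card_le hS
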